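/- **Theorem.** Let $k\ge 2$ and $m_1,\dots,m_k\ge 1$ be integers, and let $H=H_{m_1,\dots,m_k}$ be the following cubic caterpillar-Halin graph. Put $n_1=m_1$, $n_k=m_k$, $n_i=m_i+1$ for $1<i<k$, and $\ell=n_1+\dots+n_k$. Take a horizontal path $v_0v_1\cdots v_{\ell+1}$ in the plane and attach to each $v_p$ with $1\le p\le \ell$ a pendent edge $v_pu_p$, vertically up or down, so that from left to right the pendent edges form $k$ maximal blocks of consecutive edges of the same direction, of sizes $n_1,n_2,\dots,n_k$, the directions of the blocks alternating. The graph $H$ is this tree together with the cycle through its leaves $u_0=v_0$, the up leaves from left to right, $u_{\ell+1}=v_{\ell+1}$, and the down leaves from right to left. A general rotation system $(\rho,\lambda)$ of a graph consists of a cyclic permutation $\rho_v$ of the edges at each vertex $v$ and a map $\lambda$ from the edges to $\{0,1\}$ (an edge $e$ is twisted if $\lambda(e)=1$); it determines a cellular embedding of the graph into a closed surface. The Euler-genus of a closed surface $S$ is $2-\chi(S)$, i.e. $2j$ for the orientable surface with $j$ handles and $c$ for the nonorientable surface with $c$ crosscaps. For a spanning tree $T$, a $T$-rotation system is a general rotation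 system with $\lambda(e)=0$ for every edge $e$ of $T$. Let $\varepsilon_{m_1,\dots,m_k}(2)$ be the number of $T$-rotation systems of $H$ whose surface has Euler-genus $2$ (torus or Klein bottle). Then, for every spanning tree $T$ of $H$, $$\begin{aligned}\varepsilon_{m_1,\dots,m_k}(2)={}&8\sum_{i=1}^k\bigl(-9+4i+(-3+4i)m_i+2m_i^2\bigr)+2\sum_{i=2}^k\bigl(2^{m_i+3}+3\cdot 2^{m_{i-1}+3}\bigr)\\&-2^{m_1+5}+32\sum_{i=2}^k\sum_{j=1}^{i-1}(m_jm_i+m_j).\end{aligned}$$ -/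

import Mathlib

/-!
General rotation systems, the surfaces they determine, and cubic caterpillar-Halin graphs.
-/

/-- A general rotation system `(ρ, λ)` of a simple graph `G`.
`rot` sends a dart (an edge together with the choice of its end `d.fst`) to the next dart around
the same vertex: its cycles are exactly the sets of darts that issue from one vertex, so that it
is a choice of a cyclic permutation `ρ_v` of the edges at each vertex `v`.
`twist e = true` means `λ(e) = 1` (the edge `e` is twisted). -/
@[ext]
structure GeneralRotationSystem {V : Type*} (G : SimpleGraph V) where
  rot : Equiv.Perm G.Dart
  sameCycle_iff : ∀ d d' : G.Dart, rot.SameCycle d d' ↔ d.fst = d'.fst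
  twist : G.edgeSet → Bool

namespace GeneralRotationSystem

variable {V : Type*} {G : SimpleGraph V}

/-- One step along the boundary of the band decomposition (ribbon surface) given by `(ρ, λ)`.
Every vertex is a disc and every edge a band. The pair `(d, b)` stands for the corner at which one
of the two sides of the band of `d` meets the disc of `d.fst`: the side facing the next dart in
the rotation if `b = true`, the side facing the previous dart if `b = false`.
* `corner`: along the disc, the `true` side of `d` is joined to the `false` side of `rot d`.
* `side`: along the band, each side of `d` is joined to a side of the reversed dart `d.symm`,
  the opposite one if the edge is untwisted and the one with the same name if it is twisted. -/
inductive BoundaryStep (R : GeneralRotationSystem G) : G.Dart × Bool → G.Dart × Bool → Prop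
  | corner (d : G.Dart) : BoundaryStep R (d, true) (R.rot d, false)
  | side (d : G.Dart) (b : Bool) :
      BoundaryStep R (d, b) (d.symm, xor (!b) (R.twist ⟨d.edge, d.edge_mem⟩))

/-- The faces of the embedding: the boundary components of the ribbon surface, that is, the
classes of the equivalence relation generated by the boundary steps. -/
def Face (R : GeneralRotationSystem G) : Type _ :=
  Quot R.BoundaryStep

/-- The Euler genus `2 - χ` of the closed surface obtained by gluing a disc to every boundary
component, where `χ = |V| - |E| + |F|` (for `G` finite, connected, with at least one edge). It is
`2 j` for the orientable surface with `j` handles and `k` for the nonorientable surface with `k`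
crosscaps. -/
noncomputable def eulerGenus (R : GeneralRotationSystem G) : ℤ :=
  2 - ((Nat.card V : ℤ) - (Nat.card G.edgeSet : ℤ) + (Nat.card R.Face : ℤ))

/-- `(ρ, λ)` is a `T`-rotation system: all edges of `T` are untwisted. -/
def IsTreeRotationSystem (R : GeneralRotationSystem G) (T : SimpleGraph V) : Prop :=
  ∀ e : G.edgeSet, (e : Sym2 V) ∈ T.edgeSet → R.twist e = false

end GeneralRotationSystem

/-- The number of embeddings of `G` into surfaces of Euler genus `i`, counted as `T`-rotation
systems (`T` a spanning tree of `G`). -/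
noncomputable def embeddingCount {V : Type*} (G T : SimpleGraph V) (i : ℤ) : ℕ :=
  Nat.card {R : GeneralRotationSystem G // R.IsTreeRotationSystem T ∧ R.eulerGenus = i}

namespace CaterpillarHalin

/-- Vertices for a spine of length `ℓ = s.length`: `Sum.inl p` with `0 ≤ p ≤ ℓ + 1` is the vertex
`v_p` of the horizontal path `v_0 v_1 … v_{ℓ+1}`, and `Sum.inr i` with `0 ≤ i < ℓ` is the leaf
`u_{i+1}` pendent from `v_{i+1}`; `s` lists from left to right whether the pendent edges go up
(`true`) or down (`false`). -/
abbrev Vertex (s : List Bool) : Type :=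
  Fin (s.length + 2) ⊕ Fin s.length

/-- The leaf `u_p` for `0 ≤ p ≤ ℓ + 1`, where `u_0 = v_0` and `u_{ℓ+1} = v_{ℓ+1}`. -/
def leaf (s : List Bool) (p : Fin (s.length + 2)) : Vertex s :=
  if h : 0 < p.val ∧ p.val ≤ s.length then Sum.inr ⟨p.val - 1, by omega⟩ else Sum.inl p

/-- `u_p` lies on side `c` of the outer cycle (`true` the upper, `false` the lower one); the two
ends `u_0` and `u_{ℓ+1}` lie on both sides. -/
def OnSide (s : List Bool) (c : Bool) (p : Fin (s.length + 2)) : Prop :=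
  p = 0 ∨ p = Fin.last (s.length + 1) ∨ ∃ i : Fin s.length, p = i.succ.castSucc ∧ s.get i = c

/-- The cubic Halin graph of the caterpillar described by `s`: the spine path, the pendent edges,
and the outer cycle, which joins consecutive leaves on the upper side and on the lower side. -/
def graph (s : List Bool) : SimpleGraph (Vertex s) :=
  SimpleGraph.fromRel fun x y =>
    (∃ p : Fin (s.length + 1), x = Sum.inl p.castSucc ∧ y = Sum.inl p.succ) ∨
    (∃ i : Fin s.length, x = Sum.inl i.succ.castSucc ∧ y = Sum.inr i) ∨
    (∃ (c : Bool) (p q : Fin (s.length + 2)), p < q ∧ OnSide s c p ∧ OnSide s c q ∧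
      (∀ r, p < r → r < q → ¬ OnSide s c r) ∧ x = leaf s p ∧ y = leaf s q)

/-- Number of pendent edges in the `i`-th maximal block (`1 ≤ i ≤ k`): `m_1` and `m_k` for the
two end blocks, `m_i + 1` for the inner ones. -/
def blockSize (k : ℕ) (m : ℕ → ℕ) (i : ℕ) : ℕ :=
  if i = 1 ∨ i = k then m i else m i + 1

/-- The up/down word of `H_{m_1,…,m_k}`: `k` blocks, alternately up and down, starting with up. -/
def sides (k : ℕ) (m : ℕ → ℕ) : List Bool :=
  (List.range k).flatMap fun i => List.replicate (blockSize k m (i + 1)) (decide (Even i))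

/-- The graph `H_{m_1,…,m_k}`; only the values `m 1, …, m k` matter. -/
def H (k : ℕ) (m : ℕ → ℕ) : SimpleGraph (Vertex (sides k m)) :=
  graph (sides k m)

end CaterpillarHalin

/-! At a vertex of degree three there are only two rotations, so a general rotation system is a pair
(S, l): one bit per vertex and one bit per edge. Reversing the rotation at a vertex while toggling
the twists of its edges leaves the ribbon surface unchanged, so the number F of faces depends only
on μ = l + δS, where δ is the coboundary mod 2. For a given μ, the T-rotation systems are the pairs
for which δS agrees with μ on T, and a spanning tree admits exactly two such S. The count is
therefore twice the number of μ with the required F, for every T (`CubicFrame.embeddingCount_eq`).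

To find F, one counts the Boolean functions on the corners that are constant along the boundary;
there are 2^F of them. A vertical cut between v_p and v_{p+1} crosses three edges, with six corners
beside them, and the functions are summed out cut by cut from left to right. The boundary arcs left
of a cut always pair up the six points, and further arcs may have closed into curves. A pendent edge
thus sends one perfect matching to another and splits off at most one curve (`push_weight`), and F
is the total number of closed curves (`card_isEdgeInvariant`).

After summation over all edge bits only the kind of a matching matters (`loopCount_eq`), which gives
a linear recurrence along the up/down word. The maximum F = ℓ + 3 is the sphere, and Euler genus 2
means F = ℓ + 1, so the third coefficient from the top is needed (`kindCount_values`). Its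
increments are linear in the remaining length, up to boundary terms, plus two values of `fan`. These
double along a run of letters of the other side and are reset to 8 at a letter of their own side;
this is the source of the powers of two, one family per block. Summation over the runs
(`secondCount_runWord`) and rearrangement in terms of the m_i (`two_mul_secondCount_sides`) give the
formula. -/

/-- A cyclic labelling by `Fin 3` of the darts that issue from each vertex of a cubic graph. -/
structure CubicFrame {V : Type*} (G : SimpleGraph V) where
  dart : V × Fin 3 ≃ G.Dart
  dart_fst : ∀ x, (dart x).fst = x.1

/-! ### Rotation systems of a cubic graph modulo reversal at vertices. -/

namespace CubicFrame

open GeneralRotationSystem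

variable {V : Type*} {G : SimpleGraph V} (fr : CubicFrame G)

/-- The offset of the successor (`true`) or predecessor (`false`) corner, where a corner at a vertex
is named by the slot of the opposite dart. -/
def sgn (b : Bool) : Fin 3 := if b then 2 else 1

/-- The slot at the other end of the edge. -/
def opp (x : V × Fin 3) : V × Fin 3 := fr.dart.symm (fr.dart x).symm

/-- The edge of a slot. -/
def edge (x : V × Fin 3) : G.edgeSet := ⟨(fr.dart x).edge, (fr.dart x).edge_mem⟩

@[simp] lemma dart_opp (x : V × Fin 3) : fr.dart (fr.opp x) = (fr.dart x).symm := by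
  simp [opp]

@[simp] lemma edge_opp (x : V × Fin 3) : fr.edge (fr.opp x) = fr.edge x := by
  simp [edge]

lemma edge_surjective : Function.Surjective fr.edge := by
  rintro ⟨e, he⟩
  induction e with
  | _ a b =>
    refine ⟨fr.dart.symm ⟨(a, b), he⟩, ?_⟩
    simp [edge, SimpleGraph.Dart.edge]

lemma edge_eq (x : V × Fin 3) : (fr.edge x : Sym2 V) = s(x.1, (fr.opp x).1) := by
  have h := fr.dart_fst (fr.opp x)
  rw [dart_opp] at h
  rw [← fr.dart_fst x, ← h]
  rfl

/-- The coboundary of a set of vertices. -/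
def coboundary (S : V → Bool) (e : G.edgeSet) : Bool :=
  Sym2.lift ⟨fun a b => xor (S a) (S b), fun _ _ => Bool.xor_comm _ _⟩ (e : Sym2 V)

lemma coboundary_edge (S : V → Bool) (x : V × Fin 3) :
    coboundary S (fr.edge x) = xor (S x.1) (S (fr.opp x).1) := by
  rw [coboundary, edge_eq]; rfl

lemma add_sgn_add_sgn (i : Fin 3) (b : Bool) : i + sgn b + sgn (!b) = i := by
  revert i b; decide

lemma add_sgn_not_add_sgn (i : Fin 3) (b : Bool) : i + sgn (!b) + sgn b = i := by
  revert i b; decide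

/-- The rotation that is the cyclic order of the frame at the vertices with `S v = false` and its
inverse at the others. -/
def slotRot (S : V → Bool) : Equiv.Perm (V × Fin 3) where
  toFun x := (x.1, x.2 + sgn (S x.1))
  invFun x := (x.1, x.2 + sgn (!S x.1))
  left_inv _ := Prod.ext rfl (add_sgn_add_sgn _ _)
  right_inv _ := Prod.ext rfl (add_sgn_not_add_sgn _ _)

lemma slotRot_apply (S : V → Bool) (x : V × Fin 3) :
    slotRot S x = (x.1, x.2 + sgn (S x.1)) := rfl

lemma slotRot_sameCycle (S : V → Bool) (x y : V × Fin 3) :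
    (slotRot S).SameCycle x y ↔ x.1 = y.1 := by
  constructor
  · rintro ⟨n, rfl⟩
    have key : ∀ (n : ℕ) (z : V × Fin 3), ((slotRot S ^ n) z).1 = z.1 := by
      intro n
      induction n with
      | zero => intro z; rfl
      | succ n ih => intro z; rw [pow_succ, Equiv.Perm.mul_apply, ih]; rfl
    cases n with
    | ofNat n => exact (key n x).symm
    | negSucc n =>
      have := key (n + 1) ((slotRot S ^ (Int.negSucc n)) x)
      rw [← this, zpow_negSucc]
      simp
  · obtain ⟨v, i⟩ := x
    obtain ⟨w, j⟩ := y
    rintro (rfl : v = w)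
    have h : j = i ∨ j = i + sgn (S v) ∨ j = i + sgn (S v) + sgn (S v) := by
      generalize S v = b
      revert i j b; decide
    rcases h with rfl | rfl | rfl
    · exact Equiv.Perm.SameCycle.refl _ _
    · exact ⟨1, rfl⟩
    · exact ⟨2, rfl⟩

/-- The general rotation system with rotation prescribed by `S` and twisted edges prescribed
by `l`. -/
def mk' (S : V → Bool) (l : G.edgeSet → Bool) : GeneralRotationSystem G where
  rot := fr.dart.permCongr (slotRot S)
  sameCycle_iff d d' := by
    have h := slotRot_sameCycle S (fr.dart.symm d) (fr.dart.symm d')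
    have h1 := fr.dart_fst (fr.dart.symm d)
    have h2 := fr.dart_fst (fr.dart.symm d')
    rw [Equiv.apply_symm_apply] at h1 h2
    rw [h1, h2, ← h]
    constructor
    · rintro ⟨n, hn⟩
      refine ⟨n, ?_⟩
      rw [← hn]
      have := map_zpow (fr.dart.permCongrHom) (slotRot S) n
      simp only [Equiv.permCongrHom_coe] at this
      rw [← this]
      simp
    · rintro ⟨n, hn⟩
      refine ⟨n, ?_⟩
      have := map_zpow (fr.dart.permCongrHom) (slotRot S) n
      simp only [Equiv.permCongrHom_coe] at this
      rw [← this]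
      simp [hn]
  twist := l

lemma mk'_rot (S : V → Bool) (l : G.edgeSet → Bool) (x : V × Fin 3) :
    (fr.mk' S l).rot (fr.dart x) = fr.dart (x.1, x.2 + sgn (S x.1)) := by
  simp [mk', slotRot_apply]

lemma perm_fin_three (p : Fin 3 → Fin 3) (hp : Function.Injective p) (h : ∀ i, p i ≠ i) :
    ∃ b, ∀ i, p i = i + sgn b := by
  revert p; decide

/-- A rotation that is a single cycle on three slots has no fixed point, and the fixed-point-free
permutations of `Fin 3` are the two shifts. -/
lemma mk'_surjective (R : GeneralRotationSystem G) : ∃ S, fr.mk' S R.twist = R := by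
  have hfst : ∀ d, (R.rot d).fst = d.fst := fun d =>
    ((R.sameCycle_iff d (R.rot d)).1 ⟨1, rfl⟩).symm
  have key : ∀ v, ∃ b, ∀ i, R.rot (fr.dart (v, i)) = fr.dart (v, i + sgn b) := by
    intro v
    have h1 : ∀ i, (fr.dart.symm (R.rot (fr.dart (v, i)))).1 = v := by
      intro i
      rw [← fr.dart_fst, Equiv.apply_symm_apply, hfst, fr.dart_fst]
    obtain ⟨b, hb⟩ := perm_fin_three (fun i => (fr.dart.symm (R.rot (fr.dart (v, i)))).2)
      (by
        intro i j hij
        have : fr.dart.symm (R.rot (fr.dart (v, i))) = fr.dart.symm (R.rot (fr.dart (v, j))) :=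
          Prod.ext ((h1 i).trans (h1 j).symm) hij
        simpa using this)
      (by
        intro i hi
        -- A fixed dart would be a cycle by itself, although the next slot lies at the same vertex.
        have hfix : R.rot (fr.dart (v, i)) = fr.dart (v, i) := by
          rw [← Equiv.symm_apply_eq]
          exact Prod.ext (h1 i) hi
        obtain ⟨n, hn⟩ := (R.sameCycle_iff (fr.dart (v, i)) (fr.dart (v, i + 1))).2
          (by rw [fr.dart_fst, fr.dart_fst])
        have hz : (R.rot ^ n) (fr.dart (v, i)) = fr.dart (v, i) :=
          Function.IsFixedPt.perm_zpow hfix n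
        rw [hz] at hn
        have h2 := congrArg Prod.snd (fr.dart.injective hn)
        dsimp only at h2
        revert h2; clear * -; revert i; decide)
    refine ⟨b, fun i => ?_⟩
    rw [← Equiv.symm_apply_eq]
    exact Prod.ext (h1 i) (hb i)
  choose S hS using key
  refine ⟨S, ?_⟩
  refine GeneralRotationSystem.ext (Equiv.ext fun d => ?_) rfl
  obtain ⟨⟨v, i⟩, rfl⟩ := fr.dart.surjective d
  rw [mk'_rot, hS]

lemma mk'_injective {S S' : V → Bool} {l l' : G.edgeSet → Bool} (h : fr.mk' S l = fr.mk' S' l') :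
    S = S' ∧ l = l' := by
  refine ⟨funext fun v => ?_, congrArg GeneralRotationSystem.twist h⟩
  have h1 := fr.mk'_rot S l (v, 0)
  rw [h, mk'_rot] at h1
  have h2 := congrArg Prod.snd (fr.dart.injective h1)
  dsimp only at h2
  revert h2
  generalize S v = a
  generalize S' v = b
  revert a b; decide

/-- `c` assigns a value to every corner, and the values are constant along the boundary
components of the ribbon surface whose rotation is that of the frame and whose twisted edges are
given by `μ`. -/
def IsInvariant (μ : G.edgeSet → Bool) (c : V × Fin 3 → Bool) : Prop :=
  ∀ x b, c (x.1, x.2 + sgn b) = c ((fr.opp x).1, (fr.opp x).2 + sgn (xor (!b) (μ (fr.edge x))))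

lemma two_pow_card_quot {α : Type*} [Finite α] (r : α → α → Prop) :
    2 ^ Nat.card (Quot r) = Nat.card {g : α → Bool // ∀ a b, r a b → g a = g b} := by
  have e : {g : α → Bool // ∀ a b, r a b → g a = g b} ≃ (Quot r → Bool) :=
    { toFun := fun g => Quot.lift g.1 g.2
      invFun := fun f => ⟨fun a => f (Quot.mk r a), fun _ _ h => congrArg f (Quot.sound h)⟩
      left_inv := fun g => rfl
      right_inv := fun f => by ext q; induction q using Quot.ind; rfl }
  rw [Nat.card_congr e, Nat.card_fun]
  simp

/-- Each corner has two names, one from each dart beside it, and a corner step identifies them. This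
passes from any name to the standard one used in `faceFunctionEquiv`. -/
lemma face_aux (S : V → Bool) (l : G.edgeSet → Bool) (g : G.Dart × Bool → Bool)
    (hg : ∀ a b, (fr.mk' S l).BoundaryStep a b → g a = g b) (v : V) (i : Fin 3) (b : Bool) :
    g (fr.dart (v, i), xor b (S v)) = g (fr.dart (v, i + sgn b + 1), !S v) := by
  cases b
  · have h := fun i => hg _ _ (BoundaryStep.corner (fr.dart (v, i)))
    simp only [mk'_rot] at h
    cases hS : S v
    · have h2 := h (i + 2)
      have h3 : ∀ i : Fin 3, i + 2 + sgn false = i ∧ i + sgn false + 1 = i + 2 := by decide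
      rw [hS, (h3 i).1] at h2
      rw [(h3 i).2]
      exact h2.symm
    · have h2 := h i
      have h3 : ∀ i : Fin 3, i + sgn false + 1 = i + sgn true := by decide
      rw [hS] at h2
      rw [h3]
      exact h2
  · have h3 : ∀ i : Fin 3, i + sgn true + 1 = i := by decide
    rw [h3, Bool.true_xor]

/-- The functions on the faces are the invariant functions on the corners. -/
def faceFunctionEquiv (S : V → Bool) (l : G.edgeSet → Bool) :
    {g : G.Dart × Bool → Bool // ∀ a b, (fr.mk' S l).BoundaryStep a b → g a = g b} ≃
      {c // fr.IsInvariant (fun e => xor (l e) (coboundary S e)) c} where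
  toFun g := ⟨fun x => g.1 (fr.dart (x.1, x.2 + 1), !S x.1), by
    rintro ⟨v, i⟩ b
    dsimp only
    rw [coboundary_edge]
    rw [← fr.face_aux S l g.1 g.2 v i b, ← fr.face_aux S l g.1 g.2, Prod.mk.eta, dart_opp]
    have h := g.2 _ _ (BoundaryStep.side (fr.dart (v, i)) (xor b (S v)))
    -- A reversed rotation swaps the names of the two sides at its vertex; here p is the twist and
    -- q, r are the bits of `S` at the two ends, so the effective twist is p + q + r.
    have h3 : ∀ b p q r : Bool, xor (!xor b q) p = xor (xor (!b) (xor p (xor q r))) r := by decide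
    rw [h, ← h3]
    rfl⟩
  invFun c := ⟨fun y => c.1 ((fr.dart.symm y.1).1,
        (fr.dart.symm y.1).2 + sgn (xor y.2 (S (fr.dart.symm y.1).1))), by
    rintro _ _ (⟨d⟩ | ⟨d, b⟩)
    · obtain ⟨⟨v, i⟩, rfl⟩ := fr.dart.surjective d
      simp only [mk'_rot, Equiv.symm_apply_apply]
      have h3 : ∀ (i : Fin 3) (q : Bool),
        i + sgn (xor true q) = i + sgn q + sgn (xor false q) := by decide
      rw [h3]
    · obtain ⟨⟨v, i⟩, rfl⟩ := fr.dart.surjective d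
      have h := c.2 (v, i) (xor b (S v))
      dsimp only at h
      rw [coboundary_edge] at h
      simp only [Equiv.symm_apply_apply]
      have h3 : ∀ b p q r : Bool,
        xor (!xor b q) (xor p (xor q r)) = xor (xor (!b) p) r := by decide
      rw [h, h3]
      rfl⟩
  left_inv g := by
    ext ⟨d, b⟩
    obtain ⟨⟨v, i⟩, rfl⟩ := fr.dart.surjective d
    simp only [Equiv.symm_apply_apply]
    rw [← fr.face_aux S l g.1 g.2, Bool.xor_assoc, Bool.xor_self, Bool.xor_false]
  right_inv c := by
    ext ⟨v, i⟩
    have h3 : ∀ (i : Fin 3) (q : Bool), i + 1 + sgn (xor (!q) q) = i := by decide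
    simp only [Equiv.symm_apply_apply, h3]

lemma two_pow_card_face [Finite V] (S : V → Bool) (l : G.edgeSet → Bool) :
    2 ^ Nat.card (fr.mk' S l).Face =
      Nat.card {c // fr.IsInvariant (fun e => xor (l e) (coboundary S e)) c} := by
  have : Finite (G.Dart × Bool) := by
    have := Finite.of_equiv _ fr.dart
    infer_instance
  rw [Face, two_pow_card_quot]
  exact Nat.card_congr (fr.faceFunctionEquiv S l)

lemma eq_of_coboundary_eq {T : SimpleGraph V} (hT : T.Connected) {S S' : V → Bool} (v : V)
    (hv : S v = S' v) (h : ∀ a b, T.Adj a b → xor (S a) (S b) = xor (S' a) (S' b)) : S = S' := by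
  funext w
  obtain ⟨p⟩ := hT.preconnected v w
  induction p with
  | nil => exact hv
  | cons hab p ih =>
    apply ih
    have := h _ _ hab
    rw [hv] at this
    simpa using this

/-- The map from S to its value at v and its coboundary on T is injective because T is connected.
Both sides have 2^|V| elements because a tree has |V| - 1 edges, so it is bijective. -/
lemma exists_coboundary_eq [Finite V] {T : SimpleGraph V} (hT : T.IsTree) (v : V) (b : Bool)
    (t : T.edgeSet → Bool) : ∃ S : V → Bool, S v = b ∧ ∀ e : T.edgeSet, coboundary S e = t e := by
  classical
  have := Fintype.ofFinite V
  let f : (V → Bool) → Bool × (T.edgeSet → Bool) := fun S => (S v, fun e => coboundary S e)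
  have hf : Function.Bijective f := by
    rw [Fintype.bijective_iff_injective_and_card]
    constructor
    · intro S S' h
      refine eq_of_coboundary_eq hT.connected v (congrArg Prod.fst h) fun a b hab => ?_
      exact congrFun (congrArg Prod.snd h) ⟨s(a, b), hab⟩
    · have h := hT.card_edgeFinset
      simp only [Fintype.card_fun, Fintype.card_prod, Fintype.card_bool]
      rw [← SimpleGraph.edgeFinset_card, ← h, pow_succ, mul_comm]
  obtain ⟨S, hS⟩ := hf.surjective (b, t)
  exact ⟨S, congrArg Prod.fst hS, fun e => congrFun (congrArg Prod.snd hS) e⟩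

/-- The number of invariant functions is two to the number of faces, and exactly two
`T`-rotation systems lead to each set of twisted edges. -/
theorem embeddingCount_eq [Finite V] {T : SimpleGraph V} (hTG : T ≤ G) (hT : T.IsTree) (i : ℤ) :
    embeddingCount G T i = 2 * Nat.card {μ : G.edgeSet → Bool //
      ∃ F : ℕ, Nat.card {c // fr.IsInvariant μ c} = 2 ^ F ∧
        2 - ((Nat.card V : ℤ) - (Nat.card G.edgeSet : ℤ) + F) = i} := by
  obtain ⟨v⟩ := hT.connected.nonempty
  rw [embeddingCount]
  -- For p = (b, μ), the coboundary of S is μ on T, so the twist μ + δS vanishes there. The bit b,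
  -- the value of S at v, accounts for the factor 2.
  choose S hS using fun (p : Bool × (G.edgeSet → Bool)) =>
    exists_coboundary_eq hT v p.1 (fun e => p.2 ⟨e, SimpleGraph.edgeSet_mono hTG e.2⟩)
  let R : Bool × (G.edgeSet → Bool) → GeneralRotationSystem G := fun p =>
    fr.mk' (S p) (fun e => xor (p.2 e) (coboundary (S p) e))
  have hgenus : ∀ S l, (fr.mk' S l).eulerGenus = i ↔ ∃ F : ℕ,
      Nat.card {c // fr.IsInvariant (fun e => xor (l e) (coboundary S e)) c} = 2 ^ F ∧
        2 - ((Nat.card V : ℤ) - (Nat.card G.edgeSet : ℤ) + F) = i := by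
    intro S l
    rw [← two_pow_card_face, eulerGenus]
    constructor
    · exact fun h => ⟨_, rfl, h⟩
    · rintro ⟨F, h1, h2⟩
      rw [Nat.pow_right_injective le_rfl h1]
      exact h2
  have hR : ∀ p : Bool × (G.edgeSet → Bool), (R p).eulerGenus = i ↔ ∃ F : ℕ,
      Nat.card {c // fr.IsInvariant p.2 c} = 2 ^ F ∧
        2 - ((Nat.card V : ℤ) - (Nat.card G.edgeSet : ℤ) + F) = i := by
    intro p
    rw [hgenus]
    simp only [Bool.xor_assoc, Bool.xor_self, Bool.xor_false]
  suffices h : Nat.card (Bool × {μ : G.edgeSet → Bool //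
      ∃ F : ℕ, Nat.card {c // fr.IsInvariant μ c} = 2 ^ F ∧
        2 - ((Nat.card V : ℤ) - (Nat.card G.edgeSet : ℤ) + F) = i}) =
      Nat.card {R : GeneralRotationSystem G // R.IsTreeRotationSystem T ∧ R.eulerGenus = i} by
    rw [← h, Nat.card_prod]
    simp
  refine Nat.card_congr (Equiv.ofBijective
    (fun p => ⟨R (p.1, p.2.1), ?_, (hR _).2 p.2.2⟩) ⟨?_, ?_⟩)
  · intro e he
    have h : coboundary (S (p.1, p.2.1)) e = p.2.1 e := (hS (p.1, p.2.1)).2 ⟨e, he⟩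
    change xor (p.2.1 e) _ = false
    rw [h, Bool.xor_self]
  · rintro ⟨b, μ, hμ⟩ ⟨b', μ', hμ'⟩ h
    obtain ⟨h1, h2⟩ := fr.mk'_injective (congrArg Subtype.val h)
    have hb : b = b' := by
      have h3 := (hS (b, μ)).1
      have h4 := (hS (b', μ')).1
      dsimp only at h1 h3 h4
      rw [← h3, ← h4, h1]
    subst hb
    have : μ = μ' := by
      funext e
      have h3 := congrFun h2 e
      dsimp only at h1 h3
      rw [h1] at h3
      simpa using h3
    subst this
    rfl
  · rintro ⟨Q, hQ, hQi⟩
    obtain ⟨S', hS'⟩ := fr.mk'_surjective Q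
    generalize Q.twist = l at hS'
    subst hS'
    refine ⟨(S' v, ⟨fun e => xor (l e) (coboundary S' e), (hgenus _ _).1 hQi⟩), ?_⟩
    -- Since l vanishes on T, the chosen function and S' have the same coboundary on T, and they
    -- agree at v.
    have hSS : S (S' v, fun e => xor (l e) (coboundary S' e)) = S' := by
      refine eq_of_coboundary_eq hT.connected v (hS _).1 fun a b hab => ?_
      have h1 := (hS (S' v, fun e => xor (l e) (coboundary S' e))).2 ⟨s(a, b), hab⟩
      have h2 : l ⟨s(a, b), hTG hab⟩ = false := hQ ⟨s(a, b), hTG hab⟩ hab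
      dsimp only at h1
      rw [h2, Bool.false_xor] at h1
      exact h1
    apply Subtype.ext
    simp only [R, hSS, Bool.xor_assoc, Bool.xor_self, Bool.xor_false]

end CubicFrame

/-! ### Transfer of corner values across vertical cuts. -/

namespace CaterpillarHalin

/-- Values at the six corners beside the three edges that cross a vertical cut: a pair for the
spine edge, one for the upper and one for the lower edge of the outer cycle. -/
abbrev Cut : Type := (Bool × Bool) × (Bool × Bool) × (Bool × Bool)

namespace Cut

/-- The pair at the outer edge on side `c`. -/
def side (c : Bool) (σ : Cut) : Bool × Bool := if c then σ.2.1 else σ.2.2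

/-- The values with spine pair `p`, pair `q` on side `c` and pair `r` on the other side. -/
def mk (c : Bool) (p q r : Bool × Bool) : Cut := if c then (p, q, r) else (p, r, q)

/-- Exchange the entries of a pair if `b` holds. -/
def swapIf (b : Bool) (p : Bool × Bool) : Bool × Bool := if b then (p.2, p.1) else p

/-- The cuts before and after a pendent edge on side `c` carry compatible values, where the spine
edge, the pendent edge and the outer edge that ends at the leaf have the bits `x`. -/
def Step (c : Bool) (x : Bool × Bool × Bool) (σ τ : Cut) : Prop :=
  τ.1.1 = (swapIf x.1 σ.1).1 ∧ (side c τ).1 = (swapIf x.2.2 (side c σ)).1 ∧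
    side (!c) τ = side (!c) σ ∧
    if x.2.1 then τ.1.2 = (side c τ).2 ∧ (swapIf x.1 σ.1).2 = (swapIf x.2.2 (side c σ)).2
    else τ.1.2 = (swapIf x.2.2 (side c σ)).2 ∧ (side c τ).2 = (swapIf x.1 σ.1).2

instance (c : Bool) (x : Bool × Bool × Bool) (σ τ : Cut) : Decidable (Step c x σ τ) := by
  unfold Step; infer_instance

/-- The six values are those around a vertex with three edges that cross the cut. -/
def AtEnd (σ : Cut) : Prop :=
  σ.1.1 = σ.2.2.2 ∧ σ.1.2 = σ.2.1.1 ∧ σ.2.1.2 = σ.2.2.1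

instance (σ : Cut) : Decidable (AtEnd σ) := by
  unfold AtEnd; infer_instance

/-- Exchange the entries of the three pairs according to three bits. -/
def twist (y : Bool × Bool × Bool) (σ : Cut) : Cut :=
  (swapIf y.1 σ.1, swapIf y.2.1 σ.2.1, swapIf y.2.2 σ.2.2)

/-- Transport of a weight through one step. -/
def push (c : Bool) (x : Bool × Bool × Bool) (Z : Cut → ℕ) (τ : Cut) : ℕ :=
  ∑ σ, if Step c x σ τ then Z σ else 0

/-- In this case the step only permutes the six values, so τ has exactly one predecessor. -/
lemma push_false (c β γ : Bool) (Z : Cut → ℕ) (τ : Cut) :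
    push c (β, false, γ) Z τ = Z (mk c (swapIf β (τ.1.1, (side c τ).2))
      (swapIf γ ((side c τ).1, τ.1.2)) (side (!c) τ)) := by
  have h : ∀ σ, Step c (β, false, γ) σ τ ↔ σ = mk c (swapIf β (τ.1.1, (side c τ).2))
      (swapIf γ ((side c τ).1, τ.1.2)) (side (!c) τ) := by
    rintro ⟨⟨s1, s2⟩, ⟨u1, u2⟩, ⟨d1, d2⟩⟩
    obtain ⟨⟨s1', s2'⟩, ⟨u1', u2'⟩, ⟨d1', d2'⟩⟩ := τ
    cases c <;> cases β <;> cases γ <;> simp [Step, mk, swapIf, side] <;> tauto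
  simp only [push, h, Finset.sum_ite_eq', Finset.mem_univ, if_true]

/-- In this case the second points of the spine pair and of the outer pair are joined to each other,
separately before and after the pendent edge. The new cut must satisfy one equation, and the common
value r on the old cut is free. -/
lemma push_true (c β γ : Bool) (Z : Cut → ℕ) (τ : Cut) :
    push c (β, true, γ) Z τ = if τ.1.2 = (side c τ).2 then
      ∑ r, Z (mk c (swapIf β (τ.1.1, r)) (swapIf γ ((side c τ).1, r)) (side (!c) τ)) else 0 := by
  have h : ∀ σ, (if Step c (β, true, γ) σ τ then Z σ else 0) = if τ.1.2 = (side c τ).2 then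
      ∑ r, if σ = mk c (swapIf β (τ.1.1, r)) (swapIf γ ((side c τ).1, r)) (side (!c) τ)
        then Z σ else 0 else 0 := by
    intro σ
    have h1 : Step c (β, true, γ) σ τ ↔ τ.1.2 = (side c τ).2 ∧
        σ = mk c (swapIf β (τ.1.1, (swapIf β σ.1).2))
          (swapIf γ ((side c τ).1, (swapIf β σ.1).2)) (side (!c) τ) := by
      obtain ⟨⟨s1, s2⟩, ⟨u1, u2⟩, ⟨d1, d2⟩⟩ := σ
      obtain ⟨⟨s1', s2'⟩, ⟨u1', u2'⟩, ⟨d1', d2'⟩⟩ := τ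
      cases c <;> cases β <;> cases γ <;> simp [Step, mk, swapIf, side] <;> tauto
    have h2 : ∀ r, σ = mk c (swapIf β (τ.1.1, r)) (swapIf γ ((side c τ).1, r)) (side (!c) τ) →
        r = (swapIf β σ.1).2 := by
      rintro r rfl
      cases c <;> cases β <;> rfl
    split_ifs with h3 h4 h4
    · rw [Finset.sum_eq_single (swapIf β σ.1).2]
      · rw [if_pos (h1.1 h3).2]
      · intro r _ hr
        exact if_neg fun h => hr (h2 r h)
      · simp
    · exact absurd (h1.1 h3).1 h4
    · symm
      refine Finset.sum_eq_zero fun r _ => if_neg fun h => h3 (h1.2 ⟨h4, ?_⟩)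
      rw [← h2 r h]
      exact h
    · rfl
  rw [push, Finset.sum_congr rfl fun σ _ => h σ]
  split_ifs with h1
  · rw [Finset.sum_comm]
    simp
  · simp

end Cut

/-- The number of ways to continue a weighted cut through the word `s`. -/
def transfer : (s : List Bool) → (Fin s.length → Bool × Bool × Bool) → Bool × Bool × Bool →
    (Cut → ℕ) → ℕ
  | [], _, y, Z => ∑ σ : Cut, if (σ.twist y).AtEnd then Z σ else 0
  | c :: s, x, y, Z => transfer s (Fin.tail x) y (Cut.push c (x 0) Z)

/-- Sequences of compatible cuts. -/
def IsCutPath (s : List Bool) (x : Fin s.length → Bool × Bool × Bool) (y : Bool × Bool × Bool)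
    (σ : Fin (s.length + 1) → Cut) : Prop :=
  (∀ i, Cut.Step (s.get i) (x i) (σ i.castSucc) (σ i.succ)) ∧ ((σ (Fin.last _)).twist y).AtEnd

instance (s : List Bool) (x : Fin s.length → Bool × Bool × Bool) (y : Bool × Bool × Bool) :
    DecidablePred (IsCutPath s x y) := fun σ => by
  unfold IsCutPath; infer_instance

lemma sum_isCutPath (s : List Bool) (x : Fin s.length → Bool × Bool × Bool)
    (y : Bool × Bool × Bool) (Z : Cut → ℕ) :
    ∑ σ, (if IsCutPath s x y σ then Z (σ 0) else 0) = transfer s x y Z := by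
  induction s generalizing Z with
  | nil =>
    rw [transfer]
    refine (Equiv.sum_comp (Equiv.funUnique (Fin 1) Cut).symm _).symm.trans ?_
    refine Finset.sum_congr rfl fun σ _ => ?_
    simp [IsCutPath]
  | cons c s ih =>
    rw [transfer, ← ih]
    refine (Equiv.sum_comp (Fin.consEquiv (fun _ : Fin (s.length + 1 + 1) => Cut)) _).symm.trans ?_
    rw [Fintype.sum_prod_type_right]
    refine Finset.sum_congr rfl fun σ _ => ?_
    have h : ∀ a, IsCutPath (c :: s) x y
        (Fin.consEquiv (fun _ : Fin (s.length + 1 + 1) => Cut) (a, σ)) ↔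
        IsCutPath s (Fin.tail x) y σ ∧ Cut.Step c (x 0) a (σ 0) := by
      intro a
      rw [and_comm]
      simp only [IsCutPath, ← and_assoc]
      refine and_congr ?_ ?_
      · exact Fin.forall_fin_succ
      · rfl
    refine (Finset.sum_congr rfl fun a _ => if_congr (h a) rfl rfl).trans ?_
    simp only [ite_and]
    split_ifs with h1
    · rfl
    · exact Finset.sum_const_zero

end CaterpillarHalin

/-! ### Perfect matchings of the six points at a cut. -/

namespace CaterpillarHalin

/-- The perfect matchings of the six corners at a cut. `tri x y z` joins point `x` of the upper pair
to point `y` of the spine pair, the other point of the spine pair to point `z` of the lower pair,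
and the two remaining points; `outer c x` joins the points of the pair on side `c`; `spine x` joins
those of the spine pair; `all` joins the points of every pair. -/
inductive Matching
  | tri (x y z : Bool)
  | outer (c x : Bool)
  | spine (x : Bool)
  | all

namespace Matching

/-- An entry of a pair. -/
def entry (p : Bool × Bool) (b : Bool) : Bool := if b then p.2 else p.1

/-- The values are constant on the classes of the matching. -/
def compatible : Matching → Cut → Bool
  | tri x y z, σ => entry σ.2.1 x == entry σ.1 y && entry σ.1 (!y) == entry σ.2.2 z &&
      entry σ.2.2 (!z) == entry σ.2.1 (!x)
  | outer c x, σ => (σ.side c).1 == (σ.side c).2 && σ.1.1 == entry (σ.side (!c)) x &&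
      σ.1.2 == entry (σ.side (!c)) (!x)
  | spine x, σ => σ.1.1 == σ.1.2 && σ.2.1.1 == entry σ.2.2 x && σ.2.1.2 == entry σ.2.2 (!x)
  | all, σ => σ.1.1 == σ.1.2 && σ.2.1.1 == σ.2.1.2 && σ.2.2.1 == σ.2.2.2

/-- The indicator of the compatible cuts. -/
def weight (π : Matching) (σ : Cut) : ℕ := if π.compatible σ then 1 else 0

/-- Reflection that moves side `c` to the upper side. -/
def reflect (c : Bool) : Matching → Matching
  | tri x y z => if c then tri x y z else tri z (!y) x
  | outer d x => outer (d == c) x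
  | spine x => spine x
  | all => all

/-- Exchange of the two points of the spine pair. -/
def swapSpine : Matching → Matching
  | tri x y z => tri x (!y) z
  | outer d x => outer d (!x)
  | spine x => spine x
  | all => all

/-- Exchange of the two points of the upper pair. -/
def swapUpper : Matching → Matching
  | tri x y z => tri (!x) y z
  | outer true x => outer true x
  | outer false x => outer false (!x)
  | spine x => spine (!x)
  | all => all

/-- The effect of exchanging the second points of the spine pair and of the upper pair. -/
def cross : Matching → Matching
  | tri false false z => tri false false (!z)
  | tri false true z => outer true z
  | tri true false z => spine (!z)
  | tri true true z => tri true true z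
  | outer true x => tri false true x
  | outer false false => outer false false
  | outer false true => all
  | spine x => tri true false (!x)
  | all => outer false true

/-- The effect of joining the second points of the spine pair and of the upper pair, and replacing
them by a new pair of joined points; with the number of closed curves that split off. -/
def cap : Matching → Matching × ℕ
  | tri false false _ => (outer false false, 0)
  | tri false true z => (tri true true z, 0)
  | tri true false z => (tri true true z, 0)
  | tri true true z => (tri true true z, 1)
  | outer true x => (tri true true x, 0)
  | outer false false => (outer false false, 1)
  | outer false true => (outer false false, 0)
  | spine x => (tri true true (!x), 0)
  | all => (outer false false, 0)

/-- The effect of one pendent edge on side `c`, with the bits `x`. -/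
def next (c : Bool) (x : Bool × Bool × Bool) (π : Matching) : Matching × ℕ :=
  let π := reflect c π
  let π := if x.1 then swapSpine π else π
  let π := if x.2.2 then swapUpper π else π
  let r := if x.2.1 then cap π else (cross π, 0)
  (reflect c r.1, r.2)

/-- The number of closed curves after the last vertex has been added. -/
def close : Bool × Bool × Bool → Matching → ℕ
  | y, tri a b c =>
    let n := (xor y.2.1 a).toNat + (xor (!y.1) b).toNat + (xor (!y.2.2) c).toNat
    if n = 0 then 3 else if n = 1 then 2 else 1
  | y, outer c x => if xor y.1 (xor x (bif c then y.2.2 else y.2.1)) then 2 else 1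
  | y, spine x => if xor y.2.1 (xor x y.2.2) then 2 else 1
  | _, all => 1

/-- The constructors list all 8 + 4 + 2 + 1 = 15 perfect matchings. Joining arcs to a matching gives
a matching and possibly a closed curve, on which the value is free; this is the factor 2. The
identity is a finite check. -/
lemma push_weight (c : Bool) (x : Bool × Bool × Bool) (π : Matching) (τ : Cut) :
    Cut.push c x π.weight τ = 2 ^ (next c x π).2 * (next c x π).1.weight τ := by
  obtain ⟨β, α, γ⟩ := x
  cases α
  · rw [Cut.push_false]
    rcases π with ⟨x, y, z⟩ | ⟨d, x⟩ | ⟨x⟩ | _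
    · revert c β γ τ x y z; decide +kernel
    · revert c β γ τ d x; decide +kernel
    · revert c β γ τ x; decide +kernel
    · revert c β γ τ; decide +kernel
  · rw [Cut.push_true]
    rcases π with ⟨x, y, z⟩ | ⟨d, x⟩ | ⟨x⟩ | _
    · revert c β γ τ x y z; decide +kernel
    · revert c β γ τ d x; decide +kernel
    · revert c β γ τ x; decide +kernel
    · revert c β γ τ; decide +kernel

/-- The last vertex joins the six points by a second matching; the union of two perfect matchings is
a set of closed curves, each with one free value. -/
lemma sum_weight_atEnd (y : Bool × Bool × Bool) (π : Matching) :
    ∑ σ : Cut, (if (σ.twist y).AtEnd then π.weight σ else 0) = 2 ^ close y π := by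
  rcases π with ⟨a, b, c⟩ | ⟨d, x⟩ | ⟨x⟩ | _
  · revert y a b c; decide +kernel
  · revert y d x; decide +kernel
  · revert y x; decide +kernel
  · revert y; decide +kernel

/-- This is the initial state: the matching of the first cut that comes from the corners of v_0. -/
lemma weight_tri (σ : Cut) : (tri false true true).weight σ = if σ.AtEnd then 1 else 0 := by
  revert σ; decide +kernel

end Matching
end CaterpillarHalin

/-! ### The distribution of the number of closed curves. -/

namespace CaterpillarHalin

open Matching

lemma transfer_mul (s : List Bool) (x : Fin s.length → Bool × Bool × Bool) (y : Bool × Bool × Bool)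
    (k : ℕ) (Z : Cut → ℕ) : transfer s x y (fun σ => k * Z σ) = k * transfer s x y Z := by
  induction s generalizing Z with
  | nil => simp [transfer, Finset.mul_sum]
  | cons c s ih =>
    rw [transfer, transfer, ← ih]
    refine congrArg (transfer s (Fin.tail x) y) (funext fun τ => ?_)
    simp only [Cut.push, Finset.mul_sum, mul_ite, mul_zero]

/-- The number of closed curves obtained from a matching by completing the graph. -/
def loops : (s : List Bool) → (Fin s.length → Bool × Bool × Bool) → Bool × Bool × Bool →
    Matching → ℕ
  | [], _, y, π => close y π
  | c :: s, x, y, π => (next c (x 0) π).2 + loops s (Fin.tail x) y (next c (x 0) π).1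

lemma transfer_weight (s : List Bool) (x : Fin s.length → Bool × Bool × Bool)
    (y : Bool × Bool × Bool) (π : Matching) :
    transfer s x y π.weight = 2 ^ loops s x y π := by
  induction s generalizing π with
  | nil => exact sum_weight_atEnd y π
  | cons c s ih =>
    rw [transfer, loops, pow_add, ← ih, ← transfer_mul]
    exact congrArg (transfer s (Fin.tail x) y) (funext fun τ => push_weight c (x 0) π τ)

/-- The number of choices of bits that lead to `r` closed curves. -/
def loopCount (s : List Bool) (π : Matching) (r : ℕ) : ℕ :=
  ∑ x : Fin s.length → Bool × Bool × Bool, ∑ y, if loops s x y π = r then 1 else 0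

/-- Shift of a sequence by `i`, with zeros filled in. -/
def shift (i : ℕ) (f : ℕ → ℕ) (r : ℕ) : ℕ := if i ≤ r then f (r - i) else 0

lemma loopCount_cons (c : Bool) (s : List Bool) (π : Matching) (r : ℕ) :
    loopCount (c :: s) π r =
      ∑ b, shift (next c b π).2 (loopCount s (next c b π).1) r := by
  rw [loopCount]
  refine (Equiv.sum_comp (Fin.consEquiv (fun _ : Fin (s.length + 1) => Bool × Bool × Bool))
    _).symm.trans ?_
  rw [Fintype.sum_prod_type]
  refine Finset.sum_congr rfl fun b _ => ?_
  simp only [shift, loopCount]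
  have h : ∀ x y, loops (c :: s) (Fin.consEquiv (fun _ : Fin (s.length + 1) => Bool × Bool × Bool)
      (b, x)) y π = (next c b π).2 + loops s x y (next c b π).1 := fun x y => rfl
  split_ifs with hr
  · refine Finset.sum_congr rfl fun x _ => Finset.sum_congr rfl fun y _ => if_congr ?_ rfl rfl
    rw [h]
    omega
  · refine Finset.sum_eq_zero fun x _ => Finset.sum_eq_zero fun y _ => if_neg ?_
    rw [h]
    omega

/-- The matchings up to exchanges within the pairs. -/
inductive Matching.Kind
  | tri
  | outer (c : Bool)
  | spine
  | all

/-- The kind of a matching. -/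
def Matching.kind : Matching → Kind
  | tri _ _ _ => .tri
  | outer c _ => .outer c
  | spine _ => .spine
  | all => .all

/-- The number of choices of bits that lead from a kind of matchings to `r` closed curves. -/
def kindCount : List Bool → Kind → ℕ → ℕ
  | [], .tri => fun r => if r = 3 then 1 else if r = 2 then 3 else if r = 1 then 4 else 0
  | [], .outer _ => fun r => if r = 2 then 4 else if r = 1 then 4 else 0
  | [], .spine => fun r => if r = 2 then 4 else if r = 1 then 4 else 0
  | [], .all => fun r => if r = 1 then 8 else 0
  | _ :: s, .tri => fun r => 4 * kindCount s .tri r + shift 1 (kindCount s .tri) r +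
      kindCount s .spine r + kindCount s (.outer true) r + kindCount s (.outer false) r
  | c :: s, .outer d => fun r => if d = c then 8 * kindCount s .tri r else
      4 * kindCount s (.outer d) r + 2 * shift 1 (kindCount s (.outer d)) r +
        2 * kindCount s .all r
  | _ :: s, .spine => fun r => 8 * kindCount s .tri r
  | c :: s, .all => fun r => 8 * kindCount s (.outer !c) r

lemma loopCount_nil (π : Matching) (r : ℕ) : loopCount [] π r = kindCount [] π.kind r := by
  have h : ∀ y x, loops [] x y π = close y π := fun _ _ => rfl
  have h2 : Fintype.card (Fin ([] : List Bool).length → Bool × Bool × Bool) = 1 := rfl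
  simp only [loopCount, h, Finset.sum_const, Finset.card_univ, h2, one_smul]
  by_cases hr : r ≤ 3
  · interval_cases r <;>
    rcases π with ⟨x, y, z⟩ | ⟨d, x⟩ | ⟨x⟩ | _ <;> (try revert x) <;> (try revert d) <;>
    (try revert y z) <;> decide
  · have h3 : ∀ y, close y π ≠ r := by
      intro y h
      have : close y π ≤ 3 := by
        rcases π with ⟨x, y, z⟩ | ⟨d, x⟩ | ⟨x⟩ | _ <;> simp only [close] <;> (try split_ifs) <;> omega
      omega
    simp only [h3, if_false, Finset.sum_const_zero]
    rcases π with ⟨x, y, z⟩ | ⟨d, x⟩ | ⟨x⟩ | _ <;> simp only [Matching.kind, kindCount] <;>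
      (try split_ifs) <;> omega

/-- The bits of the spine edge and of the outer edge exchange the points of their pairs
independently, so summing over them removes the dependence on how the matching joins these points.
The remaining label at the other pair does not affect the kind that follows. -/
lemma loopCount_eq (s : List Bool) (π : Matching) (r : ℕ) :
    loopCount s π r = kindCount s π.kind r := by
  induction s generalizing π r with
  | nil => exact loopCount_nil π r
  | cons c s ih =>
    have h : ∀ π, loopCount s π = kindCount s π.kind := fun π => funext (ih π)
    have h0 : ∀ f, shift 0 f = f := fun f => by funext r; simp [shift]
    rw [loopCount_cons]
    simp only [h, Fintype.sum_prod_type, Fintype.sum_bool]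
    rcases π with ⟨x, y, z⟩ | ⟨d, x⟩ | ⟨x⟩ | _
    · cases c <;> cases x <;> cases y <;> cases z <;>
      simp [next, reflect, swapSpine, swapUpper, cap, cross, kind, kindCount, h0] <;> ring
    · cases c <;> cases d <;> cases x <;>
      simp [next, reflect, swapSpine, swapUpper, cap, cross, kind, kindCount, h0] <;> ring
    · cases c <;> cases x <;>
      simp [next, reflect, swapSpine, swapUpper, cap, cross, kind, kindCount, h0] <;> ring
    · cases c <;>
      simp [next, reflect, swapSpine, swapUpper, cap, cross, kind, kindCount, h0] <;> ring

end CaterpillarHalin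

/-! ### The top coefficients and their values on a word with given runs. -/

namespace CaterpillarHalin

open Matching

/-- These are the upper bounds for the number of closed curves: s.length + 3 for `tri`, one less for
`outer` and `spine`, two less for `all`. They remove the lower kinds from the recurrences for the
top coefficients. -/
lemma kindCount_eq_zero (s : List Bool) :
    (∀ r, s.length + 4 ≤ r → kindCount s .tri r = 0) ∧
    (∀ d r, s.length + 3 ≤ r → kindCount s (.outer d) r = 0) ∧
    (∀ r, s.length + 3 ≤ r → kindCount s .spine r = 0) ∧
    (∀ r, s.length + 2 ≤ r → kindCount s .all r = 0) := by
  induction s with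
  | nil =>
    refine ⟨fun r h => ?_, fun d r h => ?_, fun r h => ?_, fun r h => ?_⟩ <;>
      simp only [List.length_nil] at h <;> simp only [kindCount] <;> split_ifs <;> omega
  | cons c s ih =>
    obtain ⟨h1, h2, h3, h4⟩ := ih
    refine ⟨fun r h => ?_, fun d r h => ?_, fun r h => ?_, fun r h => ?_⟩ <;>
      simp only [List.length_cons] at h <;> simp only [kindCount, shift]
    · rw [h1 r (by omega), h2 true r (by omega), h2 false r (by omega), h3 r (by omega),
        h1 (r - 1) (by omega)]
      simp
    · rw [h1 r (by omega), h2 d r (by omega), h4 r (by omega), h2 d (r - 1) (by omega)]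
      simp
    · rw [h1 r (by omega)]
    · rw [h2 _ r (by omega)]

/-- The number of choices of bits that lead from a matching that joins the points of the pair on
side `d` to the maximal number of closed curves. -/
def fan (d : Bool) : List Bool → ℕ
  | [] => 4
  | c :: s => if d = c then 8 else 2 * fan d s

/-- The number of choices of bits that lead to two closed curves less than the maximum,
starting from a matching of kind `tri`. -/
def secondCount : List Bool → ℕ
  | [] => 4
  | _ :: s => secondCount s + 4 * (4 * s.length + 3) + (if s = [] then 4 else 8) + fan true s +
      fan false s

lemma kindCount_values (s : List Bool) :
    kindCount s .tri (s.length + 3) = 1 ∧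
    kindCount s .tri (s.length + 2) = 4 * s.length + 3 ∧
    (∀ d, kindCount s (.outer d) (s.length + 2) = fan d s) ∧
    kindCount s .spine (s.length + 2) = (if s = [] then 4 else 8) ∧
    kindCount s .tri (s.length + 1) = secondCount s := by
  induction s with
  | nil => simp [kindCount, fan, secondCount]
  | cons c s ih =>
    obtain ⟨h1, h2, h3, h4, h5⟩ := ih
    obtain ⟨z1, z2, z3, z4⟩ := kindCount_eq_zero s
    have e1 : s.length + 1 + 3 = s.length + 4 := rfl
    have e2 : s.length + 1 + 2 = s.length + 3 := rfl
    have e3 : s.length + 1 + 1 = s.length + 2 := rfl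
    simp only [List.length_cons, kindCount, shift, e1, e2, e3]
    refine ⟨?_, ?_, fun d => ?_, ?_, ?_⟩
    · rw [z1 _ le_rfl, z2 true (s.length + 4) (by omega), z2 false (s.length + 4) (by omega),
        z3 (s.length + 4) (by omega)]
      simp [h1]
    · rw [h1, z2 true _ le_rfl, z2 false _ le_rfl, z3 _ le_rfl]
      simp [h2]; ring
    · rw [h1, z2 d _ le_rfl, z4 (s.length + 3) (by omega), fan]
      simp [h3]
    · simp [h1]
    -- With ℓ = `s.length`: the four moves that stay in `tri` without closing a curve contribute its
    -- coefficient at ℓ + 2, the move that closes one contributes that at ℓ + 1, and `spine` and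
    -- both `outer` kinds contribute their top coefficients.
    · rw [h2, h3, h3, h4, secondCount, if_pos (by omega),
        show s.length + 2 - 1 = s.length + 1 from rfl, h5]
      ring

/-- The word with runs of the given lengths, alternating and starting with `b`. -/
def runWord : Bool → List ℕ → List Bool
  | _, [] => []
  | b, r :: L => List.replicate r b ++ runWord (!b) L

/-- The exponential part of the count for a word with given run lengths. -/
def runSum : List ℕ → ℤ
  | [] => 0
  | [r] => 2 ^ (r + 2)
  | r :: r' :: L => 2 ^ (r + 3) + (if L = [] then 2 ^ (r' + 2) else 2 ^ (r' + 3)) +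
      runSum (r' :: L)

lemma fan_replicate (d c : Bool) (r : ℕ) (s : List Bool) :
    fan d (List.replicate r c ++ s) = if d = c ∧ r ≠ 0 then 8 else 2 ^ r * fan d s := by
  induction r with
  | zero => simp
  | succ r ih =>
    rw [List.replicate_succ, List.cons_append, fan, ih]
    by_cases h : d = c
    · simp [h]
    · simp [h, pow_succ]; ring

/-- Along a run of r + 1 letters b, the fan on side b is 8 after each of the r other letters and
`fan b s` at its right end, while the fan on the other side runs through `fan (!b) s` times 1, 2, …,
2^r. The other terms come from the `spine` values 8 and from summing 4 (4 t + 3) over the remaining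
lengths t. -/
lemma secondCount_replicate_append (b : Bool) (r : ℕ) (s : List Bool) (hs : s ≠ []) :
    (secondCount (List.replicate (r + 1) b ++ s) : ℤ) =
      secondCount s + fan b s + fan (!b) s * (2 ^ (r + 1) - 1) + 8 * r + 8 * (r + 1) +
        16 * (r + 1) * s.length + 8 * (r + 1) * r + 12 * (r + 1) := by
  have hb : ∀ t, fan true t + fan false t = fan b t + fan (!b) t := by
    intro t; cases b <;> simp [add_comm]
  induction r with
  | zero =>
    have := hb s
    change ((secondCount (b :: s) : ℕ) : ℤ) = _
    rw [secondCount, if_neg hs, add_assoc, this]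
    push_cast
    ring
  | succ r ih =>
    have := hb (List.replicate (r + 1) b ++ s)
    rw [List.replicate_succ, List.cons_append, secondCount, add_assoc, this, fan_replicate,
      fan_replicate]
    push_cast
    rw [ih]
    simp [hs]
    ring

lemma secondCount_replicate (b : Bool) (r : ℕ) :
    (secondCount (List.replicate (r + 1) b) : ℤ) =
      8 * (r + 3) ^ 2 - 12 * (r + 3) - 16 + 2 ^ (r + 3) := by
  have hb : ∀ t, fan true t + fan false t = fan b t + fan (!b) t := by
    intro t; cases b <;> simp [add_comm]
  induction r with
  | zero => simp [secondCount, fan]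
  | succ r ih =>
    have := hb (List.replicate (r + 1) b)
    have h1 := fan_replicate b b (r + 1) []
    have h2 := fan_replicate (!b) b (r + 1) []
    rw [List.append_nil] at h1 h2
    rw [List.replicate_succ, secondCount, add_assoc, this, h1, h2]
    push_cast
    rw [ih]
    simp [fan]
    ring

lemma length_runWord (b : Bool) (L : List ℕ) : (runWord b L).length = L.sum := by
  induction L generalizing b with
  | nil => rfl
  | cons r L ih => simp [runWord, ih]

lemma fan_runWord_self (b : Bool) (r : ℕ) (L : List ℕ) (hr : 1 ≤ r) :
    fan b (runWord b (r :: L)) = 8 := by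
  rw [runWord, fan_replicate, if_pos ⟨rfl, by omega⟩]

lemma fan_runWord_not (b : Bool) (r : ℕ) (L : List ℕ) (hL : ∀ x ∈ L, 1 ≤ x) :
    fan (!b) (runWord b (r :: L)) = if L = [] then 2 ^ (r + 2) else 2 ^ (r + 3) := by
  rw [runWord, fan_replicate, if_neg (by simp)]
  cases L with
  | nil => simp [runWord, fan]; ring
  | cons r' L => rw [fan_runWord_self _ _ _ (hL r' (by simp))]; simp; ring

/-- The word enters only through its total length, its number of runs, and exponentials in the run
lengths. Prepending a run adds the exponential of its own length and, through the fan of its letter,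
another one of the length of the next run. A run at the right end has no letter behind it to reset
the fan to 8, hence the exponent r + 2 in place of r + 3. -/
lemma secondCount_runWord (b : Bool) (L : List ℕ) (hL : ∀ x ∈ L, 1 ≤ x) (hne : L ≠ []) :
    (secondCount (runWord b L) : ℤ) =
      8 * (L.sum + 2) ^ 2 - 12 * (L.sum + 2) - 16 * L.length + runSum L := by
  obtain ⟨r, L, rfl⟩ := List.exists_cons_of_ne_nil hne
  clear hne
  induction L generalizing b r with
  | nil =>
    obtain ⟨r, rfl⟩ : ∃ q, r = q + 1 := ⟨r - 1, by have := hL r (by simp); omega⟩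
    simp only [runWord, List.append_nil, secondCount_replicate]
    simp [runSum]
    ring
  | cons r' L ih =>
    have ih := ih (!b) r' (fun x hx => hL x (List.mem_cons_of_mem _ hx))
    obtain ⟨r, rfl⟩ : ∃ q, r = q + 1 := ⟨r - 1, by have := hL r (by simp); omega⟩
    have hr' : 1 ≤ r' := hL r' (by simp)
    have hne : runWord (!b) (r' :: L) ≠ [] := by
      rw [← List.length_pos_iff, length_runWord, List.sum_cons]
      omega
    have h1 := fan_runWord_self (!b) r' L hr'
    have h2 := fan_runWord_not (!b) r' L (fun x hx => hL x (by simp [hx]))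
    rw [Bool.not_not] at h2
    rw [runWord, secondCount_replicate_append _ _ _ hne, ih, h1, h2, length_runWord, runSum]
    simp only [List.sum_cons, List.length_cons]
    push_cast
    split_ifs <;> ring

end CaterpillarHalin

/-! ### The closed formula in terms of the block parameters. -/

namespace CaterpillarHalin

lemma flatMap_replicate_eq_runWord (f : ℕ → ℕ) (a n : ℕ) :
    (List.range' a n).flatMap (fun i => List.replicate (f i) (decide (Even i))) =
      runWord (decide (Even a)) ((List.range' a n).map f) := by
  induction n generalizing a with
  | zero => rfl
  | succ n ih =>
    rw [List.range'_succ, List.flatMap_cons, ih, List.map_cons, runWord]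
    by_cases h : Even a <;> simp [Nat.even_add_one, h]

lemma sides_eq_runWord (k : ℕ) (m : ℕ → ℕ) :
    sides k m = runWord true ((List.range' 0 k).map fun i => blockSize k m (i + 1)) := by
  rw [sides, List.range_eq_range', flatMap_replicate_eq_runWord fun i => blockSize k m (i + 1)]
  rfl

lemma runSum_map_range' (f : ℕ → ℕ) (a n : ℕ) :
    runSum ((List.range' a (n + 2)).map f) =
      ∑ i ∈ Finset.range (n + 1), ((2 : ℤ) ^ (f (a + i) + 3) + 2 ^ (f (a + i + 1) + 3)) := by
  induction n generalizing a with
  | zero => simp [List.range'_succ, runSum]; ring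
  | succ n ih =>
    rw [Finset.sum_range_succ']
    have h := ih (a + 1)
    rw [List.range'_succ, List.map_cons] at h
    rw [List.range'_succ, List.range'_succ, List.map_cons, List.map_cons, runSum, h, if_neg]
    · rw [add_comm]
      simp only [add_zero, add_assoc, add_comm, add_left_comm]
    · simp

/-- The double sum supplies the mixed products in the square of Σ (m_i + 1), which is ℓ + 2 for the
graph in question. Induction on k compares the increments. -/
lemma sum_polynomial_part (m : ℕ → ℕ) (k : ℕ) :
    8 * ∑ i ∈ Finset.Icc 1 k,
          (-9 + 4 * (i : ℤ) + (-3 + 4 * (i : ℤ)) * (m i : ℤ) + 2 * (m i : ℤ) ^ 2)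
        + 32 * ∑ i ∈ Finset.Icc 2 k, ∑ j ∈ Finset.Icc 1 (i - 1),
            ((m j : ℤ) * (m i : ℤ) + (m j : ℤ)) =
      16 * (∑ i ∈ Finset.Icc 1 k, (m i : ℤ) + k) ^ 2 -
        24 * (∑ i ∈ Finset.Icc 1 k, (m i : ℤ) + k) - 32 * k := by
  induction k with
  | zero => simp
  | succ k ih =>
    rcases k with _ | k
    · simp; ring
    · have h : ∑ j ∈ Finset.Icc 1 (k + 1), ((m j : ℤ) * (m (k + 1 + 1) : ℤ) + (m j : ℤ)) =
          (∑ j ∈ Finset.Icc 1 (k + 1), (m j : ℤ)) * m (k + 1 + 1) +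
            ∑ j ∈ Finset.Icc 1 (k + 1), (m j : ℤ) := by
        rw [Finset.sum_add_distrib, Finset.sum_mul]
      rw [Finset.sum_Icc_succ_top (by omega), Finset.sum_Icc_succ_top (by omega : 1 ≤ k + 1 + 1),
        Finset.sum_Icc_succ_top (by omega : 2 ≤ k + 1 + 1), Nat.add_sub_cancel, h]
      push_cast at ih ⊢
      linear_combination ih

lemma sum_Icc_eq_sum_range {M : Type*} [AddCommMonoid M] (f : ℕ → M) (a n : ℕ) :
    ∑ i ∈ Finset.Icc a (a + n), f i = ∑ i ∈ Finset.range (n + 1), f (a + i) := by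
  rw [← Finset.Ico_add_one_right_eq_Icc, Finset.sum_Ico_eq_sum_range]
  congr 2
  omega

theorem two_mul_secondCount_sides (k : ℕ) (hk : 2 ≤ k) (m : ℕ → ℕ)
    (hm : ∀ i ∈ Finset.Icc 1 k, 1 ≤ m i) :
    2 * (secondCount (sides k m) : ℤ) =
      8 * ∑ i ∈ Finset.Icc 1 k,
          (-9 + 4 * (i : ℤ) + (-3 + 4 * (i : ℤ)) * (m i : ℤ) + 2 * (m i : ℤ) ^ 2)
        + 2 * ∑ i ∈ Finset.Icc 2 k, ((2 : ℤ) ^ (m i + 3) + 3 * 2 ^ (m (i - 1) + 3))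
        - 2 ^ (m 1 + 5)
        + 32 * ∑ i ∈ Finset.Icc 2 k, ∑ j ∈ Finset.Icc 1 (i - 1),
            ((m j : ℤ) * (m i : ℤ) + (m j : ℤ)) := by
  obtain ⟨K, rfl⟩ : ∃ K, k = K + 2 := ⟨k - 2, by omega⟩
  have hf0 : blockSize (K + 2) m (0 + 1) = m 1 := by simp [blockSize]
  have hfl : blockSize (K + 2) m (K + 1 + 1) = m (K + 2) := by simp [blockSize]
  have hfi : ∀ i ∈ Finset.range K, blockSize (K + 2) m (i + 1 + 1) = m (i + 2) + 1 := by
    intro i hi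
    rw [Finset.mem_range] at hi
    rw [blockSize, if_neg (by omega)]
  have hpos : ∀ x ∈ (List.range' 0 (K + 2)).map fun i => blockSize (K + 2) m (i + 1), 1 ≤ x := by
    intro x hx
    rw [List.mem_map] at hx
    obtain ⟨i, hi, rfl⟩ := hx
    rw [List.mem_range'_1] at hi
    have := hm (i + 1) (Finset.mem_Icc.2 ⟨by omega, by omega⟩)
    simp only [blockSize]
    split_ifs <;> omega
  -- Each of the K = k - 2 inner blocks exceeds its m_i by one.
  have hsum : (((List.range' 0 (K + 2)).map fun i => blockSize (K + 2) m (i + 1)).sum : ℤ) =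
      ∑ i ∈ Finset.Icc 1 (K + 2), (m i : ℤ) + K := by
    have h : ((List.range' 0 (K + 2)).map fun i => blockSize (K + 2) m (i + 1)).sum =
        ∑ i ∈ Finset.range (K + 2), blockSize (K + 2) m (i + 1) := by
      rw [← List.range_eq_range']; rfl
    rw [h, Finset.sum_range_succ, Finset.sum_range_succ', hf0, hfl, Finset.sum_congr rfl hfi,
      show K + 2 = 1 + (K + 1) by omega, sum_Icc_eq_sum_range, Finset.sum_range_succ,
      Finset.sum_range_succ', Finset.sum_add_distrib]
    simp only [show ∀ i, 1 + (i + 1) = i + 2 by omega]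
    simp
    ring
  -- An inner block lies in two adjacent pairs and has size m_i + 1, so its weight is 8 · 2^(m_i +
  -- 3) = 2 (1 + 3) 2^(m_i + 3). The end blocks have weight 2 · 2^(m_i + 3); the sum on the right
  -- gives the first block three times that, and the subtracted power corrects this.
  have hexp : 2 * (∑ i ∈ Finset.range (K + 1),
      ((2 : ℤ) ^ (blockSize (K + 2) m (0 + i + 1) + 3) +
        2 ^ (blockSize (K + 2) m (0 + i + 1 + 1) + 3))) =
      2 * ∑ i ∈ Finset.Icc 2 (K + 2), ((2 : ℤ) ^ (m i + 3) + 3 * 2 ^ (m (i - 1) + 3)) -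
        2 ^ (m 1 + 5) := by
    have h1 : ∀ i ∈ Finset.range K, (2 : ℤ) ^ (blockSize (K + 2) m (i + 1 + 1) + 3) =
        2 * 2 ^ (m (i + 2) + 3) := by
      intro i hi
      rw [hfi i hi]
      ring
    have h2 : ∑ i ∈ Finset.Icc 2 (K + 2), ((2 : ℤ) ^ (m i + 3) + 3 * 2 ^ (m (i - 1) + 3)) =
        ∑ i ∈ Finset.range (K + 1), ((2 : ℤ) ^ (m (i + 2) + 3) + 3 * 2 ^ (m (i + 1) + 3)) := by
      rw [add_comm K 2, sum_Icc_eq_sum_range]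
      refine Finset.sum_congr rfl fun i _ => ?_
      rw [add_comm 2 i, show i + 2 - 1 = i + 1 from rfl]
    rw [h2]
    simp only [zero_add]
    rw [Finset.sum_add_distrib, Finset.sum_add_distrib, Finset.sum_range_succ', Finset.sum_range_succ,
      Finset.sum_congr rfl h1, ← Finset.mul_sum, ← Finset.mul_sum, hf0, hfl, Finset.sum_range_succ,
      Finset.sum_range_succ' (fun i => (2 : ℤ) ^ (m (i + 1) + 3))]
    ring
  have hcount := secondCount_runWord true _ hpos (by simp)
  rw [sides_eq_runWord, hcount, runSum_map_range' (fun i => blockSize (K + 2) m (i + 1)), hsum]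
  have hpoly := sum_polynomial_part m (K + 2)
  simp only [List.length_map, List.length_range']
  push_cast at hpoly ⊢
  linear_combination hexp - hpoly

end CaterpillarHalin

/-! ### Edges of the caterpillar-Halin graph and their slots. -/

namespace CaterpillarHalin

variable (s : List Bool)

/-- The edges of the caterpillar-Halin graph: `outer i` is the edge of the outer cycle that comes
to the leaf `u_{i+1}` from the left, and `last c` is the one on side `c` that comes to `u_{ℓ+1}`. -/
inductive Edge
  | spine (p : Fin (s.length + 1))
  | pendent (i : Fin s.length)
  | outer (i : Fin s.length)
  | last (c : Bool)

/-- The edges as a sum type. -/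
def edgeEquiv : Edge s ≃ Fin (s.length + 1) ⊕ Fin s.length ⊕ Fin s.length ⊕ Bool where
  toFun
    | .spine p => .inl p
    | .pendent i => .inr (.inl i)
    | .outer i => .inr (.inr (.inl i))
    | .last c => .inr (.inr (.inr c))
  invFun
    | .inl p => .spine p
    | .inr (.inl i) => .pendent i
    | .inr (.inr (.inl i)) => .outer i
    | .inr (.inr (.inr c)) => .last c
  left_inv e := by cases e <;> rfl
  right_inv e := by rcases e with p | i | i | c <;> rfl

instance : Finite (Edge s) := Finite.of_equiv _ (edgeEquiv s).symm

lemma card_edge : Nat.card (Edge s) = 3 * s.length + 3 := by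
  rw [Nat.card_congr (edgeEquiv s)]
  simp
  ring

/-- The left end of the edge of the outer cycle on side `c` that crosses the cut between `v_p` and
`v_{p+1}`, with the slot of the edge there. -/
def outerSlot (c : Bool) : ℕ → Vertex s × Fin 3
  | 0 => (Sum.inl 0, if c then 0 else 1)
  | p + 1 => if h : p < s.length then
      if s.get ⟨p, h⟩ = c then (Sum.inr ⟨p, h⟩, 2) else outerSlot c p
    else outerSlot c p

/-- The left end of an edge, with the slot of the edge there. -/
def leftSlot : Edge s → Vertex s × Fin 3
  | .spine p => (Sum.inl p.castSucc, 2)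
  | .pendent i => (Sum.inl i.succ.castSucc, 0)
  | .outer i => outerSlot s (s.get i) i
  | .last c => outerSlot s c s.length

/-- The right end of an edge, with the slot of the edge there. -/
def rightSlot : Edge s → Vertex s × Fin 3
  | .spine p => (Sum.inl p.succ, 1)
  | .pendent i => (Sum.inr i, 0)
  | .outer i => (Sum.inr i, 1)
  | .last c => (Sum.inl (Fin.last _), if c then 2 else 0)

/-- The slot at one end of an edge. -/
def edgeSlot (e : Edge s × Bool) : Vertex s × Fin 3 :=
  if e.2 then rightSlot s e.1 else leftSlot s e.1

variable {s}

/-- Horizontal position of a vertex. -/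
def position : Vertex s → ℕ
  | .inl p => p
  | .inr i => i + 1

/-- The side on which a slot of the left end of an outer edge lies. -/
def slotSide : Vertex s × Fin 3 → Bool
  | (.inl _, j) => j = 0
  | (.inr i, _) => s.get i

lemma outerSlot_succ_of_eq {c : Bool} (i : Fin s.length) (h : s.get i = c) :
    outerSlot s c (i + 1) = (Sum.inr i, 2) := by
  rw [outerSlot, dif_pos i.2, if_pos h]

lemma outerSlot_succ_of_ne {c : Bool} (i : Fin s.length) (h : s.get i ≠ c) :
    outerSlot s c (i + 1) = outerSlot s c i := by
  rw [outerSlot, dif_pos i.2, if_neg h]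

lemma outerSlot_cases (c : Bool) (p : ℕ) :
    outerSlot s c p = (Sum.inl 0, if c then 0 else 1) ∨
      ∃ i : Fin s.length, outerSlot s c p = (Sum.inr i, 2) ∧ s.get i = c := by
  induction p with
  | zero => exact Or.inl rfl
  | succ p ih =>
    by_cases h1 : p < s.length
    · by_cases h2 : s.get ⟨p, h1⟩ = c
      · exact Or.inr ⟨⟨p, h1⟩, outerSlot_succ_of_eq ⟨p, h1⟩ h2, h2⟩
      · rwa [outerSlot_succ_of_ne ⟨p, h1⟩ h2]
    · rwa [outerSlot, dif_neg h1]

lemma slotSide_outerSlot (c : Bool) (p : ℕ) : slotSide (outerSlot s c p) = c := by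
  rcases outerSlot_cases (s := s) c p with h | ⟨i, h, hc⟩
  · rw [h]; cases c <;> simp [slotSide]
  · rw [h]; exact hc

lemma position_outerSlot_le (c : Bool) (p : ℕ) : position (outerSlot s c p).1 ≤ p := by
  induction p with
  | zero => exact le_rfl
  | succ p ih =>
    rw [outerSlot]
    split_ifs with h1 h2
    · exact le_rfl
    · omega
    · omega

lemma le_position_outerSlot {c : Bool} (i : Fin s.length) (h : s.get i = c) (p : ℕ) (hp : i < p) :
    i + 1 ≤ position (outerSlot s c p).1 := by
  induction p with
  | zero => omega
  | succ p ih =>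
    rcases Nat.lt_succ_iff_lt_or_eq.1 hp with h1 | h1
    · rw [outerSlot]
      split_ifs with h2 h3
      · exact Nat.succ_le_succ h1.le
      · exact ih h1
      · exact ih h1
    · rw [← h1, outerSlot_succ_of_eq i h]
      exact le_rfl

/-- The slot determines its side. For i < j on one side, the edge that arrives at the later leaf
starts at position i + 1 or beyond, while the edge that arrives at the earlier one starts at
position at most i. -/
lemma outerSlot_inj (i j : Fin s.length) (h : outerSlot s (s.get i) i = outerSlot s (s.get j) j) :
    i = j := by
  have hc : s.get i = s.get j := by
    rw [← slotSide_outerSlot (s := s) (s.get i) i, h, slotSide_outerSlot]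
  have key : ∀ i j : Fin s.length, s.get i = s.get j →
      outerSlot s (s.get i) i = outerSlot s (s.get j) j → ¬ i < j := by
    intro i j hc h hij
    have h1 := le_position_outerSlot i hc j hij
    have h2 := position_outerSlot_le (s := s) (s.get i) i
    rw [h] at h2
    omega
  have h1 := key i j hc h
  have h2 := key j i hc.symm h.symm
  omega

lemma outerSlot_ne_length (i : Fin s.length) (c : Bool) :
    outerSlot s (s.get i) i ≠ outerSlot s c s.length := by
  intro h
  have hc : s.get i = c := by
    rw [← slotSide_outerSlot (s := s) (s.get i) i, h, slotSide_outerSlot]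
  have h1 := le_position_outerSlot i hc s.length i.2
  have h2 := position_outerSlot_le (s := s) (s.get i) i
  rw [h] at h2
  omega

lemma leftSlot_injective : Function.Injective (leftSlot s) := by
  have h1 : ∀ (p : Fin (s.length + 1)) c q, (Sum.inl p.castSucc, 2) ≠ outerSlot s c q := by
    intro p c q h
    rcases outerSlot_cases (s := s) c q with h' | ⟨i, h', -⟩ <;> rw [h'] at h
    · cases c <;> simp at h
    · simp at h
  have h2 : ∀ (i : Fin s.length) c q, (Sum.inl i.succ.castSucc, 0) ≠ outerSlot s c q := by
    intro p c q h
    rcases outerSlot_cases (s := s) c q with h' | ⟨i, h', -⟩ <;> rw [h'] at h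
    · simp at h
    · simp at h
  rintro (p | i | i | c) (p' | i' | i' | c') h <;> simp only [leftSlot] at h
  · simpa using h
  · simp at h
  · exact absurd h (h1 _ _ _)
  · exact absurd h (h1 _ _ _)
  · simp at h
  · simpa using h
  · exact absurd h (h2 _ _ _)
  · exact absurd h (h2 _ _ _)
  · exact absurd h.symm (h1 _ _ _)
  · exact absurd h.symm (h2 _ _ _)
  · rw [outerSlot_inj _ _ h]
  · exact absurd h (outerSlot_ne_length _ _)
  · exact absurd h.symm (h1 _ _ _)
  · exact absurd h.symm (h2 _ _ _)
  · exact absurd h.symm (outerSlot_ne_length _ _)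
  · rw [← slotSide_outerSlot (s := s) c s.length, h, slotSide_outerSlot]

lemma rightSlot_injective : Function.Injective (rightSlot s) := by
  rintro (p | i | i | c) (p' | i' | i' | c') h <;> simp only [rightSlot] at h <;>
    (try cases c) <;> (try cases c') <;> simp [Fin.ext_iff] at h <;>
    first | rfl | (congr 1; ext; exact h)

lemma leftSlot_ne_rightSlot (e e' : Edge s) : leftSlot s e ≠ rightSlot s e' := by
  have h1 : ∀ c q, outerSlot s c q ≠ rightSlot s e' := by
    intro c q h
    have hv := congrArg Prod.fst h
    have hj := congrArg Prod.snd h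
    rcases outerSlot_cases (s := s) c q with h' | ⟨i, h', -⟩ <;> rw [h'] at hv hj <;>
      rcases e' with p | i | i | d <;> simp only [rightSlot, reduceCtorEq] at hv hj
    · exact Fin.succ_ne_zero p (Sum.inl_injective hv).symm
    · exact Fin.last_pos.ne (Sum.inl_injective hv)
    · exact absurd hj (by decide)
    · exact absurd hj (by decide)
  rcases e with p | i | i | c
  · intro h
    rcases e' with p' | i' | i' | d <;> simp [rightSlot, leftSlot, Fin.ext_iff] at h
    omega
  · intro h
    rcases e' with p' | i' | i' | d <;> simp [rightSlot, leftSlot, Fin.ext_iff] at h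
    omega
  · exact h1 _ _
  · exact h1 _ _

/-- Injectivity suffices, since 2 (3ℓ + 3) = 3 (2ℓ + 2). -/
lemma edgeSlot_bijective : Function.Bijective (edgeSlot s) := by
  rw [Nat.bijective_iff_injective_and_card]
  constructor
  · rintro ⟨e, b⟩ ⟨e', b'⟩ h
    cases b <;> cases b' <;> simp only [edgeSlot, if_true, Bool.false_eq_true, if_false] at h
    · rw [leftSlot_injective h]
    · exact absurd h (leftSlot_ne_rightSlot _ _)
    · exact absurd h.symm (leftSlot_ne_rightSlot _ _)
    · rw [rightSlot_injective h]
  · rw [Nat.card_prod, card_edge]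
    simp
    ring

end CaterpillarHalin

/-! ### Identification of slots with darts: the cubic frame. -/

namespace CaterpillarHalin

variable {s : List Bool}

lemma leaf_zero : leaf s 0 = Sum.inl 0 := by
  simp [leaf]

lemma leaf_last : leaf s (Fin.last _) = Sum.inl (Fin.last _) := by
  simp [leaf]

lemma leaf_succ (i : Fin s.length) : leaf s i.succ.castSucc = Sum.inr i := by
  rw [leaf, dif_pos ⟨Nat.succ_pos _, i.2⟩]
  rfl

lemma onSide_succ {c : Bool} (i : Fin s.length) : OnSide s c i.succ.castSucc ↔ s.get i = c := by
  constructor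
  · rintro (h | h | ⟨j, h, hc⟩)
    · simp [Fin.ext_iff] at h
    · simp [Fin.ext_iff] at h
      omega
    · have : i = j := by simpa using h
      rwa [this]
  · exact fun h => Or.inr (Or.inr ⟨i, rfl, h⟩)

/-- The recursion of `outerSlot` remembers the last leaf met on side c. This links it to the
definition of the outer cycle by consecutive leaves. -/
lemma exists_leaf_eq_outerSlot (c : Bool) (p : ℕ) (hp : p ≤ s.length) :
    ∃ q : Fin (s.length + 2), (outerSlot s c p).1 = leaf s q ∧ q.val ≤ p ∧ OnSide s c q ∧
      ∀ r : Fin (s.length + 2), q < r → r.val ≤ p → ¬ OnSide s c r := by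
  induction p with
  | zero =>
    refine ⟨0, leaf_zero.symm, le_rfl, Or.inl rfl, fun r h1 h2 => ?_⟩
    rw [Fin.lt_def, Fin.val_zero] at h1
    omega
  | succ p ih =>
    obtain ⟨i, rfl⟩ : ∃ i : Fin s.length, p = i := ⟨⟨p, hp⟩, rfl⟩
    by_cases h : s.get i = c
    · refine ⟨i.succ.castSucc, ?_, le_rfl, (onSide_succ i).2 h, fun r h1 h2 => ?_⟩
      · rw [outerSlot_succ_of_eq i h, leaf_succ]
      · rw [Fin.lt_def] at h1
        simp only [Fin.val_castSucc, Fin.val_succ] at h1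
        omega
    · obtain ⟨q, h1, h2, h3, h4⟩ := ih (by omega)
      refine ⟨q, ?_, by omega, h3, fun r hr1 hr2 hr => ?_⟩
      · rw [outerSlot_succ_of_ne i h, h1]
      · rcases Nat.le_succ_iff.1 hr2 with h5 | h5
        · exact h4 r hr1 h5 hr
        · have : r = i.succ.castSucc := Fin.ext h5
          rw [this, onSide_succ] at hr
          exact h hr

lemma outerSlot_fst_eq_leaf {c : Bool} {p q : Fin (s.length + 2)} (hpq : p < q)
    (hp : OnSide s c p) (h : ∀ r, p < r → r < q → ¬ OnSide s c r) (n : ℕ) (hn : q.val = n + 1) :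
    (outerSlot s c n).1 = leaf s p := by
  obtain ⟨q', h1, h2, h3, h4⟩ := exists_leaf_eq_outerSlot (s := s) c n (by omega)
  rw [h1]
  rw [Fin.lt_def] at hpq
  rcases lt_trichotomy p q' with h5 | h5 | h5
  · exact absurd h3 (h q' h5 (by rw [Fin.lt_def]; omega))
  · rw [h5]
  · exact absurd hp (h4 p h5 (by omega))

lemma position_left_le_right (e : Edge s) :
    (leftSlot s e).1 ≠ (rightSlot s e).1 ∧
      position (leftSlot s e).1 ≤ position (rightSlot s e).1 := by
  have h : ∀ x y : Vertex s, position x < position y → x ≠ y ∧ position x ≤ position y :=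
    fun x y hxy => ⟨fun h => by rw [h] at hxy; omega, hxy.le⟩
  rcases e with p | i | i | c
  · exact h _ _ (Nat.lt_succ_self _)
  · exact ⟨Sum.inl_ne_inr, le_rfl⟩
  · exact h _ _ (Nat.lt_succ_of_le (position_outerSlot_le _ _))
  · exact h _ _ (Nat.lt_succ_of_le (position_outerSlot_le _ _))

lemma graph_adj_iff (x y : Vertex s) : (graph s).Adj x y ↔ ∃ e : Edge s,
    (x = (leftSlot s e).1 ∧ y = (rightSlot s e).1) ∨
      (y = (leftSlot s e).1 ∧ x = (rightSlot s e).1) := by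
  have key : ∀ x y : Vertex s, ((∃ p : Fin (s.length + 1), x = Sum.inl p.castSucc ∧
      y = Sum.inl p.succ) ∨
      (∃ i : Fin s.length, x = Sum.inl i.succ.castSucc ∧ y = Sum.inr i) ∨
      (∃ (c : Bool) (p q : Fin (s.length + 2)), p < q ∧ OnSide s c p ∧ OnSide s c q ∧
        (∀ r, p < r → r < q → ¬ OnSide s c r) ∧ x = leaf s p ∧ y = leaf s q)) ↔
      ∃ e : Edge s, x = (leftSlot s e).1 ∧ y = (rightSlot s e).1 := by
    intro x y
    constructor
    · rintro (⟨p, rfl, rfl⟩ | ⟨i, rfl, rfl⟩ | ⟨c, p, q, hpq, hp, hq, hr, rfl, rfl⟩)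
      · exact ⟨.spine p, rfl, rfl⟩
      · exact ⟨.pendent i, rfl, rfl⟩
      · rcases hq with rfl | rfl | ⟨i, rfl, hc⟩
        · simp at hpq
        · exact ⟨.last c, (outerSlot_fst_eq_leaf hpq hp hr _ rfl).symm, leaf_last⟩
        · refine ⟨.outer i, ?_, leaf_succ i⟩
          rw [leftSlot, hc]
          exact (outerSlot_fst_eq_leaf hpq hp hr _ rfl).symm
    · rintro ⟨p | i | i | c, rfl, rfl⟩
      · exact Or.inl ⟨p, rfl, rfl⟩
      · exact Or.inr (Or.inl ⟨i, rfl, rfl⟩)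
      · obtain ⟨q, h1, h2, h3, h4⟩ := exists_leaf_eq_outerSlot (s := s) (s.get i) i i.2.le
        refine Or.inr (Or.inr ⟨s.get i, q, i.succ.castSucc, ?_, h3, (onSide_succ i).2 rfl, ?_, h1,
          (leaf_succ i).symm⟩)
        · rw [Fin.lt_def]
          exact Nat.lt_succ_of_le h2
        · exact fun r hr1 hr2 => h4 r hr1 (Nat.le_of_lt_succ hr2)
      · obtain ⟨q, h1, h2, h3, h4⟩ := exists_leaf_eq_outerSlot (s := s) c s.length le_rfl
        refine Or.inr (Or.inr ⟨c, q, Fin.last _, ?_, h3, Or.inr (Or.inl rfl), ?_, h1,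
          leaf_last.symm⟩)
        · rw [Fin.lt_def]
          exact Nat.lt_succ_of_le h2
        · exact fun r hr1 hr2 => h4 r hr1 (Nat.le_of_lt_succ hr2)
  rw [graph, SimpleGraph.fromRel_adj, key, key, ← exists_or]
  constructor
  · exact fun h => h.2
  · rintro ⟨e, h⟩
    refine ⟨?_, e, h⟩
    rcases h with ⟨rfl, rfl⟩ | ⟨rfl, rfl⟩
    · exact (position_left_le_right e).1
    · exact (position_left_le_right e).1.symm

/-- The two darts of an edge. -/
def edgeDart (e : Edge s × Bool) : (graph s).Dart where
  fst := (edgeSlot s e).1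
  snd := (edgeSlot s (e.1, !e.2)).1
  adj := by
    obtain ⟨e, b⟩ := e
    refine (graph_adj_iff _ _).2 ⟨e, ?_⟩
    cases b
    · exact Or.inl ⟨rfl, rfl⟩
    · exact Or.inr ⟨rfl, rfl⟩

lemma edgeDart_symm (e : Edge s) (b : Bool) : (edgeDart (e, b)).symm = edgeDart (e, !b) := by
  cases b <;> rfl

lemma outerSlot_length_ne (hs : ∀ c, ∃ i, s.get i = c) (c : Bool) :
    ∃ i : Fin s.length, outerSlot s c s.length = (Sum.inr i, 2) ∧ s.get i = c := by
  rcases outerSlot_cases (s := s) c s.length with h | h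
  · obtain ⟨i, hi⟩ := hs c
    have := le_position_outerSlot i hi s.length i.2
    rw [h] at this
    simp [position] at this
  · exact h

/-- There are no parallel edges, which a simple graph would merge. As both sides have a pendent
edge, the two last outer edges start at leaves on different sides, so they differ from each other
and from spine edges. -/
lemma edge_eq_of_ends_eq (hs : ∀ c, ∃ i, s.get i = c) (e e' : Edge s)
    (hl : (leftSlot s e).1 = (leftSlot s e').1) (hr : (rightSlot s e).1 = (rightSlot s e').1) :
    e = e' := by
  have key : ∀ p c, (leftSlot s (.spine p)).1 = (leftSlot s (.last c)).1 → False := by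
    intro p c h
    obtain ⟨i, h1, -⟩ := outerSlot_length_ne hs c
    rw [leftSlot, leftSlot, h1] at h
    exact Sum.inl_ne_inr h
  have key2 : ∀ i i' : Fin s.length,
      (leftSlot s (.pendent i)).1 = (leftSlot s (.outer i')).1 → i = i' → False := by
    rintro i i' h rfl
    have h1 := position_outerSlot_le (s := s) (s.get i) i
    have h2 := congrArg position h
    change (i : ℕ) + 1 = position (outerSlot s (s.get i) i).1 at h2
    omega
  rcases e with p | i | i | c <;> rcases e' with p' | i' | i' | c' <;>
    simp only [rightSlot, reduceCtorEq, Sum.inl.injEq, Sum.inr.injEq, Fin.succ_inj] at hr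
  · rw [hr]
  · exact (key _ _ hl).elim
  · rw [hr]
  · exact (key2 _ _ hl hr).elim
  · exact (key2 _ _ hl.symm hr.symm).elim
  · rw [hr]
  · exact (key _ _ hl.symm).elim
  · obtain ⟨i, h1, h2⟩ := outerSlot_length_ne hs c
    obtain ⟨i', h1', h2'⟩ := outerSlot_length_ne hs c'
    rw [leftSlot, leftSlot, h1, h1'] at hl
    rw [← h2, ← h2', Sum.inr_injective hl]

lemma edge_not_reversed (e e' : Edge s)
    (hl : (leftSlot s e).1 = (rightSlot s e').1) (hr : (rightSlot s e).1 = (leftSlot s e').1) :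
    False := by
  have h1 := (position_left_le_right e).2
  have h2 := (position_left_le_right e').2
  have h4 := congrArg position hl
  have h5 := congrArg position hr
  have key : ∀ e : Edge s, position (leftSlot s e).1 = position (rightSlot s e).1 →
      ∃ i, e = .pendent i := by
    rintro (p | i | i | c) h
    · exact absurd h (Nat.lt_succ_self _).ne
    · exact ⟨i, rfl⟩
    · exact absurd h (Nat.lt_succ_of_le (position_outerSlot_le _ _)).ne
    · exact absurd h (Nat.lt_succ_of_le (position_outerSlot_le _ _)).ne
  obtain ⟨i, rfl⟩ := key e (by omega)
  obtain ⟨i', rfl⟩ := key e' (by omega)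
  exact Sum.inl_ne_inr hl

lemma edgeDart_bijective (hs : ∀ c, ∃ i, s.get i = c) :
    Function.Bijective (edgeDart (s := s)) := by
  constructor
  · rintro ⟨e, b⟩ ⟨e', b'⟩ h
    have h1 : (edgeSlot s (e, b)).1 = (edgeSlot s (e', b')).1 := congrArg (fun d => d.fst) h
    have h2 : (edgeSlot s (e, !b)).1 = (edgeSlot s (e', !b')).1 := congrArg (fun d => d.snd) h
    cases b <;> cases b' <;>
      simp only [edgeSlot, if_true, Bool.false_eq_true, if_false, Bool.not_true, Bool.not_false]
        at h1 h2
    · rw [edge_eq_of_ends_eq hs e e' h1 h2]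
    · exact (edge_not_reversed e e' h1 h2).elim
    · exact (edge_not_reversed e e' h2 h1).elim
    · rw [edge_eq_of_ends_eq hs e e' h2 h1]
  · rintro ⟨⟨x, y⟩, h⟩
    obtain ⟨e, ⟨h1, h2⟩ | ⟨h1, h2⟩⟩ := (graph_adj_iff x y).1 h
    · exact ⟨(e, false), SimpleGraph.Dart.ext _ _ (Prod.ext h1.symm h2.symm)⟩
    · exact ⟨(e, true), SimpleGraph.Dart.ext _ _ (Prod.ext h2.symm h1.symm)⟩

/-- The slots of the caterpillar-Halin graph as a cubic frame. -/
noncomputable def frame (hs : ∀ c, ∃ i, s.get i = c) : CubicFrame (graph s) where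
  dart := (Equiv.ofBijective _ edgeSlot_bijective).symm.trans
    (Equiv.ofBijective _ (edgeDart_bijective hs))
  dart_fst x := by
    obtain ⟨e, rfl⟩ := (Equiv.ofBijective _ (edgeSlot_bijective (s := s))).surjective x
    rw [Equiv.trans_apply, Equiv.symm_apply_apply]
    rfl

lemma frame_dart (hs : ∀ c, ∃ i, s.get i = c) (e : Edge s × Bool) :
    (frame hs).dart (edgeSlot s e) = edgeDart e := by
  have h : edgeSlot s e = Equiv.ofBijective _ edgeSlot_bijective e := rfl
  rw [frame, h, Equiv.trans_apply, Equiv.symm_apply_apply]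
  rfl

lemma frame_opp (hs : ∀ c, ∃ i, s.get i = c) (e : Edge s) (b : Bool) :
    (frame hs).opp (edgeSlot s (e, b)) = edgeSlot s (e, !b) := by
  apply (frame hs).dart.injective
  rw [CubicFrame.dart_opp, frame_dart, frame_dart, edgeDart_symm]

lemma frame_edge_bijective (hs : ∀ c, ∃ i, s.get i = c) :
    Function.Bijective fun e => (frame hs).edge (leftSlot s e) := by
  constructor
  · intro e e' h
    have h1 : ((frame hs).dart (leftSlot s e)).edge = ((frame hs).dart (leftSlot s e')).edge :=
      congrArg Subtype.val h
    rcases SimpleGraph.dart_edge_eq_iff _ _ |>.1 h1 with h2 | h2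
    · exact leftSlot_injective ((frame hs).dart.injective h2)
    · rw [← CubicFrame.dart_opp] at h2
      have h3 := (frame hs).dart.injective h2
      exact absurd (h3.trans (frame_opp hs e' false)) (leftSlot_ne_rightSlot e e')
  · intro f
    obtain ⟨x, rfl⟩ := (frame hs).edge_surjective f
    obtain ⟨⟨e, b⟩, rfl⟩ := edgeSlot_bijective.surjective x
    cases b
    · exact ⟨e, rfl⟩
    · refine ⟨e, ?_⟩
      rw [← CubicFrame.edge_opp, frame_opp]
      rfl

end CaterpillarHalin

/-! ### Invariant functions as sequences of compatible cuts, and the count. -/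

namespace CaterpillarHalin

open Cut

variable {s : List Bool}

/-- The values at the two corners beside a slot. -/
def besides (c : Vertex s × Fin 3 → Bool) (x : Vertex s × Fin 3) : Bool × Bool :=
  (c (x.1, x.2 + 1), c (x.1, x.2 + 2))

/-- The conditions at the two darts of an edge coincide. In frame order an untwisted edge joins a
successor corner to a predecessor corner, hence the negated bit. -/
lemma isInvariant_iff (hs : ∀ c, ∃ i, s.get i = c) (μ : (graph s).edgeSet → Bool)
    (c : Vertex s × Fin 3 → Bool) :
    (frame hs).IsInvariant μ c ↔ ∀ e, besides c (rightSlot s e) =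
      swapIf (!μ ((frame hs).edge (leftSlot s e))) (besides c (leftSlot s e)) := by
  have hl : ∀ e, (frame hs).opp (leftSlot s e) = rightSlot s e := fun e => frame_opp hs e false
  have hr : ∀ e, (frame hs).opp (rightSlot s e) = leftSlot s e := fun e => frame_opp hs e true
  have he : ∀ e, (frame hs).edge (rightSlot s e) = (frame hs).edge (leftSlot s e) := by
    intro e
    rw [← hl, CubicFrame.edge_opp]
  constructor
  · intro h e
    have h1 := h (leftSlot s e) true
    have h2 := h (leftSlot s e) false
    rw [hl] at h1 h2
    revert h1 h2
    cases μ ((frame hs).edge (leftSlot s e)) <;> intro h1 h2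
    · exact Prod.ext h1.symm h2.symm
    · exact Prod.ext h2.symm h1.symm
  · intro h x b
    obtain ⟨⟨e, b'⟩, rfl⟩ := edgeSlot_bijective.surjective x
    have h1 := congrArg Prod.fst (h e)
    have h2 := congrArg Prod.snd (h e)
    cases b'
    · change c ((leftSlot s e).1, _) = c (((frame hs).opp (leftSlot s e)).1,
        ((frame hs).opp (leftSlot s e)).2 + CubicFrame.sgn (xor _ (μ ((frame hs).edge (leftSlot s e)))))
      rw [hl]
      revert h1 h2
      cases μ ((frame hs).edge (leftSlot s e)) <;> cases b <;> intro h1 h2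
      · exact h2.symm
      · exact h1.symm
      · exact h1.symm
      · exact h2.symm
    · change c ((rightSlot s e).1, _) = c (((frame hs).opp (rightSlot s e)).1,
        ((frame hs).opp (rightSlot s e)).2 +
          CubicFrame.sgn (xor _ (μ ((frame hs).edge (rightSlot s e)))))
      rw [hr, he]
      revert h1 h2
      cases μ ((frame hs).edge (leftSlot s e)) <;> cases b <;> intro h1 h2
      · exact h1
      · exact h2
      · exact h1
      · exact h2

/-- The bits of the three edges that end at `v_{i+1}` or `u_{i+1}` from the left. -/
def stepBits (ν : Edge s → Bool) (i : Fin s.length) : Bool × Bool × Bool :=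
  (ν (.spine i.castSucc), ν (.pendent i), ν (.outer i))

/-- The bits of the three edges at the last vertex. -/
def lastBits (ν : Edge s → Bool) : Bool × Bool × Bool :=
  (!ν (.spine (Fin.last _)), !ν (.last true), !ν (.last false))

/-- The values of a function on the corners at the cut between `v_p` and `v_{p+1}`. -/
def cutAt (c : Vertex s × Fin 3 → Bool) (p : Fin (s.length + 1)) : Cut :=
  (besides c (Sum.inl p.castSucc, 2), besides c (outerSlot s true p),
    besides c (outerSlot s false p))

lemma side_cutAt (c : Vertex s × Fin 3 → Bool) (p : Fin (s.length + 1)) (d : Bool) :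
    side d (cutAt c p) = besides c (outerSlot s d p) := by
  cases d <;> rfl

/-- The edge condition for a function on the corners. -/
def IsEdgeInvariant (ν : Edge s → Bool) (c : Vertex s × Fin 3 → Bool) : Prop :=
  ∀ e, besides c (rightSlot s e) = swapIf (!ν e) (besides c (leftSlot s e))

/-- Reading the right-hand pair backwards absorbs the negation; this is why `Step` takes the bits as
they are while `lastBits` negates them. -/
lemma swapIf_not (b : Bool) (p q : Bool × Bool) :
    q = swapIf (!b) p ↔ q.2 = (swapIf b p).1 ∧ q.1 = (swapIf b p).2 := by
  revert b p q; decide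

lemma isEdgeInvariant_iff (ν : Edge s → Bool) (c : Vertex s × Fin 3 → Bool) :
    IsEdgeInvariant ν c ↔
      (∀ i : Fin s.length,
        besides c (Sum.inl i.succ.castSucc, 1) =
          swapIf (!ν (.spine i.castSucc)) (cutAt c i.castSucc).1 ∧
        besides c (Sum.inr i, 0) =
          swapIf (!ν (.pendent i)) (besides c (Sum.inl i.succ.castSucc, 0)) ∧
        besides c (Sum.inr i, 1) =
          swapIf (!ν (.outer i)) (side (s.get i) (cutAt c i.castSucc))) ∧
      besides c (Sum.inl (Fin.last _), 1) = ((cutAt c (Fin.last _)).twist (lastBits ν)).1 ∧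
      besides c (Sum.inl (Fin.last _), 2) = ((cutAt c (Fin.last _)).twist (lastBits ν)).2.1 ∧
      besides c (Sum.inl (Fin.last _), 0) = ((cutAt c (Fin.last _)).twist (lastBits ν)).2.2 := by
  constructor
  · intro h
    refine ⟨fun i => ⟨h (.spine i.castSucc), h (.pendent i), ?_⟩, h (.spine (Fin.last _)),
      h (.last true), h (.last false)⟩
    rw [side_cutAt]
    exact h (.outer i)
  · rintro ⟨h1, h2, h3, h4⟩ (p | i | i | c)
    · induction p using Fin.lastCases with
      | last => exact h2
      | cast i => exact (h1 i).1
    · exact (h1 i).2.1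
    · have := (h1 i).2.2
      rw [side_cutAt] at this
      exact this
    · cases c
      · exact h4
      · exact h3

lemma cutAt_succ_side (c : Vertex s × Fin 3 → Bool) (i : Fin s.length) :
    side (s.get i) (cutAt c i.succ) = besides c (Sum.inr i, 2) := by
  rw [side_cutAt, Fin.val_succ, outerSlot_succ_of_eq i rfl]

lemma cutAt_succ_side_not (c : Vertex s × Fin 3 → Bool) (i : Fin s.length) :
    side (!s.get i) (cutAt c i.succ) = side (!s.get i) (cutAt c i.castSucc) := by
  rw [side_cutAt, side_cutAt, Fin.val_succ, outerSlot_succ_of_ne i (by simp)]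
  rfl

lemma cutAt_zero_atEnd (c : Vertex s × Fin 3 → Bool) : (cutAt c 0).AtEnd := by
  simp [AtEnd, cutAt, besides, outerSlot]

lemma isCutPath_cutAt {ν : Edge s → Bool} {c : Vertex s × Fin 3 → Bool}
    (h : IsEdgeInvariant ν c) : IsCutPath s (stepBits ν) (lastBits ν) (cutAt c) := by
  obtain ⟨h1, h2, h3, h4⟩ := (isEdgeInvariant_iff ν c).1 h
  refine ⟨fun i => ?_, ?_⟩
  · obtain ⟨e1, e2, e3⟩ := h1 i
    rw [swapIf_not] at e1 e3
    refine ⟨e1.1, ?_, cutAt_succ_side_not c i, ?_⟩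
    · rw [cutAt_succ_side]
      exact e3.1
    · rw [cutAt_succ_side]
      change if ν (.pendent i) then _ ∧ (swapIf (ν (.spine i.castSucc)) _).2 =
        (swapIf (ν (.outer i)) _).2 else _ = (swapIf (ν (.outer i)) _).2 ∧
          _ = (swapIf (ν (.spine i.castSucc)) _).2
      rw [← e1.2, ← e3.2]
      split_ifs with hα
      · rw [hα] at e2
        exact ⟨(congrArg Prod.fst e2).symm, (congrArg Prod.snd e2).symm⟩
      · rw [Bool.not_eq_true] at hα
        rw [hα] at e2
        exact ⟨(congrArg Prod.snd e2).symm, congrArg Prod.fst e2⟩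
  · rw [AtEnd, ← h2, ← h3, ← h4]
    exact ⟨rfl, rfl, rfl⟩

/-- The function on the corners with prescribed values at the cuts. -/
def cornersOf (ν : Edge s → Bool) (σ : Fin (s.length + 1) → Cut) : Vertex s × Fin 3 → Bool
  | (.inl p, j) =>
    Fin.cases (motive := fun _ => Bool) (![(σ 0).1.1, (σ 0).1.2, (σ 0).2.1.2] j)
      (fun q => Fin.lastCases (motive := fun _ => Bool)
        (![((σ (Fin.last _)).twist (lastBits ν)).1.2, ((σ (Fin.last _)).twist (lastBits ν)).2.1.2,
          ((σ (Fin.last _)).twist (lastBits ν)).1.1] j)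
        (fun i => ![(σ i.succ).1.1, (σ i.succ).1.2,
          (swapIf (stepBits ν i).1 (σ i.castSucc).1).2] j) q) p
  | (.inr i, j) => ![(side (s.get i) (σ i.succ)).1, (side (s.get i) (σ i.succ)).2,
      (swapIf (stepBits ν i).2.2 (side (s.get i) (σ i.castSucc))).2] j

section

variable (ν : Edge s → Bool) (σ : Fin (s.length + 1) → Cut)

lemma cornersOf_zero (j : Fin 3) :
    cornersOf ν σ (.inl 0, j) = ![(σ 0).1.1, (σ 0).1.2, (σ 0).2.1.2] j := rfl

lemma cornersOf_last (j : Fin 3) : cornersOf ν σ (.inl (Fin.last _), j) =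
    ![((σ (Fin.last _)).twist (lastBits ν)).1.2, ((σ (Fin.last _)).twist (lastBits ν)).2.1.2,
          ((σ (Fin.last _)).twist (lastBits ν)).1.1] j := by
  rw [← Fin.succ_last, cornersOf, Fin.cases_succ, Fin.lastCases_last]

lemma cornersOf_inl (i : Fin s.length) (j : Fin 3) : cornersOf ν σ (.inl i.succ.castSucc, j) =
    ![(σ i.succ).1.1, (σ i.succ).1.2, (swapIf (stepBits ν i).1 (σ i.castSucc).1).2] j := by
  rw [← Fin.succ_castSucc, cornersOf, Fin.cases_succ, Fin.lastCases_castSucc]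

lemma cornersOf_inr (i : Fin s.length) (j : Fin 3) : cornersOf ν σ (.inr i, j) =
    ![(side (s.get i) (σ i.succ)).1, (side (s.get i) (σ i.succ)).2,
      (swapIf (stepBits ν i).2.2 (side (s.get i) (σ i.castSucc))).2] j := rfl

variable {ν σ}

/-- An outer edge may cross many cuts, but its corners are stored once, at its left end. The steps
leave the pair on the opposite side unchanged, so the stored values reappear at every cut that the
edge crosses. -/
lemma besides_outerSlot_cornersOf (h0 : (σ 0).AtEnd)
    (h : ∀ i, Step (s.get i) (stepBits ν i) (σ i.castSucc) (σ i.succ)) (d : Bool)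
    (p : Fin (s.length + 1)) :
    besides (cornersOf ν σ) (outerSlot s d p) = side d (σ p) := by
  induction p using Fin.induction with
  | zero =>
    obtain ⟨h1, h2, h3⟩ := h0
    cases d
    · change besides (cornersOf ν σ) (Sum.inl 0, 1) = _
      simp only [besides, cornersOf_zero]
      exact Prod.ext h3 h1
    · exact Prod.ext h2 rfl
  | succ i ih =>
    rw [Fin.val_succ]
    by_cases hd : s.get i = d
    · rw [outerSlot_succ_of_eq i hd, ← hd]
      rfl
    · have hd' : d = !s.get i := by
        cases d <;> simpa using hd
      rw [outerSlot_succ_of_ne i hd]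
      refine ih.trans ?_
      rw [hd']
      exact (h i).2.2.1.symm

lemma cutAt_cornersOf (h0 : (σ 0).AtEnd)
    (h : ∀ i, Step (s.get i) (stepBits ν i) (σ i.castSucc) (σ i.succ)) :
    cutAt (cornersOf ν σ) = σ := by
  funext p
  refine Prod.ext ?_ (Prod.ext (besides_outerSlot_cornersOf h0 h true p)
    (besides_outerSlot_cornersOf h0 h false p))
  induction p using Fin.cases with
  | zero => rfl
  | succ i =>
    change besides (cornersOf ν σ) (.inl i.succ.castSucc, 2) = _
    rw [besides, cornersOf_inl, cornersOf_inl]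
    rfl

lemma isEdgeInvariant_cornersOf (h0 : (σ 0).AtEnd)
    (h : IsCutPath s (stepBits ν) (lastBits ν) σ) : IsEdgeInvariant ν (cornersOf ν σ) := by
  rw [isEdgeInvariant_iff, cutAt_cornersOf h0 h.1]
  refine ⟨fun i => ?_, ?_⟩
  · obtain ⟨e1, e2, e3, e4⟩ := h.1 i
    refine ⟨?_, ?_, ?_⟩
    · rw [swapIf_not, besides, cornersOf_inl, cornersOf_inl]
      exact ⟨e1, rfl⟩
    · simp only [besides, cornersOf_inl, cornersOf_inr]
      split_ifs at e4 with hα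
      · have hα' : ν (.pendent i) = true := hα
        rw [hα']
        exact Prod.ext e4.1.symm e4.2.symm
      · have hα' : ν (.pendent i) = false := Bool.eq_false_of_not_eq_true hα
        rw [hα']
        exact Prod.ext e4.2 e4.1.symm
    · rw [swapIf_not, besides, cornersOf_inr, cornersOf_inr]
      exact ⟨e2, rfl⟩
  · obtain ⟨e1, e2, e3⟩ := h.2
    simp only [besides, cornersOf_last]
    refine ⟨rfl, ?_, ?_⟩
    · exact Prod.ext e2 rfl
    · exact Prod.ext e3 e1

lemma eq_cornersOf_cutAt {c : Vertex s × Fin 3 → Bool} (h : IsEdgeInvariant ν c) :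
    cornersOf ν (cutAt c) = c := by
  obtain ⟨h1, h2, h3, h4⟩ := (isEdgeInvariant_iff ν c).1 h
  funext ⟨v, j⟩
  rcases v with p | i
  · induction p using Fin.cases with
    | zero =>
      rw [cornersOf_zero]
      fin_cases j <;> rfl
    | succ q =>
      induction q using Fin.lastCases with
      | last =>
        rw [Fin.succ_last, cornersOf_last, ← h2, ← h3]
        fin_cases j <;> rfl
      | cast i =>
        have e1 := (h1 i).1
        rw [swapIf_not] at e1
        rw [Fin.succ_castSucc, cornersOf_inl]
        simp only [stepBits]
        rw [← e1.2]
        fin_cases j <;> rfl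
  · have e3 := (h1 i).2.2
    rw [swapIf_not] at e3
    rw [cornersOf_inr, cutAt_succ_side]
    simp only [stepBits]
    rw [← e3.2]
    fin_cases j <;> rfl

end

lemma card_isEdgeInvariant (ν : Edge s → Bool) :
    Nat.card {c // IsEdgeInvariant ν c} =
      2 ^ loops s (stepBits ν) (lastBits ν) (.tri false true true) := by
  rw [← transfer_weight, ← sum_isCutPath]
  simp only [Matching.weight_tri, ← ite_and]
  rw [← Finset.card_filter, ← Fintype.card_subtype, ← Nat.card_eq_fintype_card]
  exact Nat.card_congr
    { toFun := fun c => ⟨cutAt c.1, isCutPath_cutAt c.2, cutAt_zero_atEnd c.1⟩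
      invFun := fun σ => ⟨cornersOf ν σ.1, isEdgeInvariant_cornersOf σ.2.2 σ.2.1⟩
      left_inv := fun c => Subtype.ext (eq_cornersOf_cutAt c.2)
      right_inv := fun σ => Subtype.ext (cutAt_cornersOf σ.2.2 σ.2.1.1) }

/-- A choice of bits for the edges as a choice of bits for the steps and for the last vertex. -/
def bitsEquiv (s : List Bool) : (Edge s → Bool) ≃
    (Fin s.length → Bool × Bool × Bool) × (Bool × Bool × Bool) where
  toFun ν := (stepBits ν, lastBits ν)
  invFun x
    | .spine p => Fin.lastCases (motive := fun _ => Bool) (!x.2.1) (fun i => (x.1 i).1) p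
    | .pendent i => (x.1 i).2.1
    | .outer i => (x.1 i).2.2
    | .last c => if c then !x.2.2.1 else !x.2.2.2
  left_inv ν := by
    funext e
    rcases e with p | i | i | c
    · induction p using Fin.lastCases with
      | last => simp [lastBits]
      | cast i => simp [stepBits]
    · rfl
    · rfl
    · cases c <;> simp [lastBits]
  right_inv x := by
    refine Prod.ext (funext fun i => ?_) ?_
    · simp [stepBits]
    · simp [lastBits]

theorem embeddingCount_graph (hs : ∀ c, ∃ i, s.get i = c) {T : SimpleGraph (Vertex s)}
    (hTG : T ≤ graph s) (hT : T.IsTree) :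
    embeddingCount (graph s) T 2 = 2 * secondCount s := by
  rw [(frame hs).embeddingCount_eq hTG hT]
  congr 1
  let ε : Edge s ≃ (graph s).edgeSet := Equiv.ofBijective _ (frame_edge_bijective hs)
  have hE : Nat.card (graph s).edgeSet = 3 * s.length + 3 := by
    rw [← Nat.card_congr ε, card_edge]
  have hV : Nat.card (Vertex s) = 2 * s.length + 2 := by
    simp
    ring
  rw [hE, hV, ← (kindCount_values s).2.2.2.2]
  have hk := loopCount_eq s (.tri false true true) (s.length + 1)
  rw [Matching.kind] at hk
  rw [← hk, loopCount, ← Fintype.sum_prod_type', ← Finset.card_filter, ← Fintype.card_subtype,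
    ← Nat.card_eq_fintype_card]
  refine Nat.card_congr (((Equiv.arrowCongr ε (Equiv.refl Bool)).symm.trans
    (bitsEquiv s)).subtypeEquiv fun μ => ?_)
  have hinv : ∀ c, (frame hs).IsInvariant μ c ↔ IsEdgeInvariant (μ ∘ ε) c :=
    fun c => isInvariant_iff hs μ c
  simp only [hinv, card_isEdgeInvariant]
  change _ ↔ loops s (stepBits (μ ∘ ε)) (lastBits (μ ∘ ε)) _ = _
  -- By |V| = 2ℓ + 2 and |E| = 3ℓ + 3, Euler genus 2 amounts to F = ℓ + 1.
  constructor
  · rintro ⟨F, h1, h2⟩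
    rw [Nat.pow_right_injective le_rfl h1]
    push_cast at h2
    omega
  · intro h
    refine ⟨_, rfl, ?_⟩
    rw [h]
    push_cast
    ring

lemma exists_get_sides (k : ℕ) (hk : 2 ≤ k) (m : ℕ → ℕ) (hm : ∀ i ∈ Finset.Icc 1 k, 1 ≤ m i)
    (c : Bool) : ∃ i, (sides k m).get i = c := by
  rw [← List.mem_iff_get, sides, List.mem_flatMap]
  have h : ∀ i, 1 ≤ i → i ≤ k → blockSize k m i ≠ 0 := by
    intro i h1 h2
    have := hm i (Finset.mem_Icc.2 ⟨h1, h2⟩)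
    rw [blockSize]
    split_ifs <;> omega
  cases c
  · exact ⟨1, List.mem_range.2 (by omega), List.mem_replicate.2 ⟨h _ (by omega) (by omega), rfl⟩⟩
  · exact ⟨0, List.mem_range.2 (by omega), List.mem_replicate.2 ⟨h _ (by omega) (by omega), rfl⟩⟩

end CaterpillarHalin

theorem mainTheorem4 (k : ℕ) (hk : 2 ≤ k) (m : ℕ → ℕ) (hm : ∀ i ∈ Finset.Icc 1 k, 1 ≤ m i)
    (T : SimpleGraph (CaterpillarHalin.Vertex (CaterpillarHalin.sides k m)))
    (hTH : T ≤ CaterpillarHalin.H k m) (hT : T.IsTree) :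
    (embeddingCount (CaterpillarHalin.H k m) T 2 : ℤ) =
      8 * ∑ i ∈ Finset.Icc 1 k,
          (-9 + 4 * (i : ℤ) + (-3 + 4 * (i : ℤ)) * (m i : ℤ) + 2 * (m i : ℤ) ^ 2)
        + 2 * ∑ i ∈ Finset.Icc 2 k, ((2 : ℤ) ^ (m i + 3) + 3 * 2 ^ (m (i - 1) + 3))
        - 2 ^ (m 1 + 5)
        + 32 * ∑ i ∈ Finset.Icc 2 k, ∑ j ∈ Finset.Icc 1 (i - 1),
            ((m j : ℤ) * (m i : ℤ) + (m j : ℤ)) := by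
  rw [← CaterpillarHalin.two_mul_secondCount_sides k hk m hm, CaterpillarHalin.H,
    CaterpillarHalin.embeddingCount_graph (CaterpillarHalin.exists_get_sides k hk m hm) hTH hT]
  push_cast
  rfl
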